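/- There exist absolute constants $A, C > 0$ such that the following holds. Let $d, m, n$ be natural numbers with $m \ge 1$, let $0<\varepsilon<1$, $0<\delta\le \frac12$, and let $\gamma$ be a real number with $0<|\gamma|<\varepsilon$. Suppose that $$n \;\ge\; A\cdot \frac{1}{\varepsilon^{2}} \,\log\frac1\delta \,\log^2\frac1\varepsilon \cdot \max\left( \frac{(e^{|\gamma|}-1)^2}{\gamma^2}\,\log\left(\frac m\delta \log\frac1\delta \log^2\frac1\varepsilon\right),\ (\log m + C)^2\right).$$ Let $m$ hypotheses be given, each a list of orthogonal projectors $\Pi^{(c)}_1,\dots,\Pi^{(c)}_n$ on $\mathbb C^d$ ($c=1,\dots,m$). Then there is a quantum algorithm, that is, a finite adaptive (possibly randomized) sequence of quantum measurements on $(\mathbb C^d)^{\otimes n}$, which may depend on the projectors and on $\varepsilon,\delta,\gamma$ but not on the states, that outputs an index $c^*\in\{1,\dots,m\}$ and a real number $\hat\mu_{c^*}(\gamma)$, with the following property. For all density operators $\rho_1,\dots,\rho_n$ on $\mathbb C^d$, with $$\mu_c(\gamma) = \frac1\gamma \log\left(\frac1n\sum_{i=1}^n e^{\gamma\,\mathrm{Tr}[\rho_i\Pi_i^{(c)}]}\right),$$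 the algorithm run on a single copy of $\rho_1\otimes\cdots\otimes\rho_n$ satisfies $$\Pr\left(\left|\hat\mu_{c^*}(\gamma) - \max_{c}\mu_c(\gamma)\right|\ge\varepsilon \ \text{ or }\ \left|\hat\mu_{c^*}(\gamma)-\mu_{c^*}(\gamma)\right|\ge\varepsilon\right)\le\delta .$$ -/

import Mathlib

open scoped Matrix ComplexOrder

noncomputable section

namespace QTERM

/-- A density operator on the `d`-dimensional Hilbert space `ℂ^d`. -/
def IsDensity {d : ℕ} (ρ : Matrix (Fin d) (Fin d) ℂ) : Prop :=
  ρ.PosSemidef ∧ ρ.trace = 1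

/-- The product operator `ρ₁ ⊗ ⋯ ⊗ ρₙ` on `(ℂ^d)^{⊗ n}`, as a matrix in the product basis, whose
elements are indexed by `Fin n → Fin d`. -/
def productState {n d : ℕ} (ρ : Fin n → Matrix (Fin d) (Fin d) ℂ) :
    Matrix (Fin n → Fin d) (Fin n → Fin d) ℂ :=
  Matrix.of fun a b => ∏ i, ρ i (a i) (b i)

/-- The tilted value `(1/γ) log ((1/n) ∑ᵢ exp (γ Tr[ρᵢ Πᵢ]))` of a list of operators `P` on a list
of states `ρ` (the trace is real for Hermitian arguments). -/
def tiltedValue {n d : ℕ} (γ : ℝ) (ρ P : Fin n → Matrix (Fin d) (Fin d) ℂ) : ℝ :=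
  1 / γ * Real.log (1 / (n : ℝ) * ∑ i, Real.exp (γ * ((ρ i * P i).trace).re))

/-- A quantum algorithm acting on a system with basis `D` and producing a classical output in `O`:
a finite adaptive sequence of quantum measurements. At each step it either halts with an output, or
performs a measurement with finitely many outcomes, given by Kraus operators `K j` with
`∑ⱼ Kⱼᴴ Kⱼ = 1`, and continues on the post-measurement state in a way that may depend on the
outcome. Classical randomness is included, through Kraus operators proportional to `1`. -/
inductive Algorithm (D O : Type) [Fintype D] [DecidableEq D] : Type
  | output (o : O) : Algorithm D O
  | measure (k : ℕ) (K : Fin k → Matrix D D ℂ) (complete : ∑ j, (K j)ᴴ * K j = 1)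
      (next : Fin k → Algorithm D O) : Algorithm D O

/-- The probability that the algorithm, run on `σ`, halts with an output in `S` (Born rule). Outcome
`j` turns `σ` into the unnormalized state `Kⱼ σ Kⱼᴴ`, so that the trace of the current operator is
the probability of the sequence of outcomes observed so far. -/
def Algorithm.prob {D O : Type} [Fintype D] [DecidableEq D] (S : Set O) :
    Algorithm D O → Matrix D D ℂ → ℝ
  | .output o, σ => S.indicator (fun _ => σ.trace.re) o
  | .measure k K _ next, σ => ∑ j : Fin k, (next j).prob S (K j * σ * (K j)ᴴ)

/-- The sample size
`ε⁻² log(1/δ) log²(1/ε) max ((e^|γ| - 1)² / γ² · log ((m/δ) log(1/δ) log²(1/ε)), (log m + C)²)`. -/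
def sampleSize (C : ℝ) (m : ℕ) (ε δ γ : ℝ) : ℝ :=
  1 / ε ^ 2 * Real.log (1 / δ) * Real.log (1 / ε) ^ 2 *
    max ((Real.exp |γ| - 1) ^ 2 / γ ^ 2 *
          Real.log ((m : ℝ) / δ * Real.log (1 / δ) * Real.log (1 / ε) ^ 2))
        ((Real.log m + C) ^ 2)

end QTERM

end

open scoped Matrix ComplexOrder

namespace QTERM

/-! Since `|γ| < ε`, the tilted value is within `|γ| / 4 < ε / 4` of the plain mean of `Tr[ρᵢ Πᵢ]`
(`abs_tilted_mean_sub_le`). It therefore suffices to find a hypothesis with nearly maximal mean and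
to estimate that mean.

The indices are spread uniformly at random over `B ≈ log (2/δ)` pairs of blocks of expected size `w
= n / (2B)`. With high probability all block sums are proportional to the full sums, up to `(ε/16)
w`. In each pair a gentle search on the first block proposes a hypothesis, whose projectors are then
measured on the untouched second block. The largest verified value is reported; it is accurate once
a single search succeeds and all verifications are accurate (`best_block_accurate`). A search fails
with probability at most `1/e`, independently over the pairs, so all fail with probability at most
`e^{-B} ≤ δ/2`. Chernoff and union bounds pay for balance and verification.

The search tests random hypotheses with the effect `h c = ⊗ᵢ (P + e^{-u} (1 - P))`, that is,
`e^{-u}` to the number of rejecting sites. On a product of `s` states its expectation `x c` is `exp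
(-u (s - ∑ Tr[ρᵢ Pᵢ]))` up to a factor `e^{s u²/2}`, so a hypothesis lying `Δ` below the best has
exponentially smaller weight. The relative variance of `h c` is at most `κ = e^{s u²} - 1`. Small
variance makes rejection gentle: it adds at most `x c * κ` to the probability of a later bad event,
a fraction `κ` of the acceptance scale (`trace_reject_le`). The damage summed until the search stops
is thus about `κ`, whatever the number of rounds (`searchPovm_trace_le`), and the number of
hypotheses enters only through `m e^{-uΔ}`. With `u` of order `w^{-1/2}` and `Δ` of order `ε w`, it
is enough that `ε √w` exceeds a multiple of `log m + 3`. -/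

open scoped MatrixOrder in
theorem exists_eq_conjTranspose_mul_self {D : Type} [Fintype D] [DecidableEq D]
    {A : Matrix D D ℂ} (hA : A.PosSemidef) : ∃ K : Matrix D D ℂ, A = Kᴴ * K :=
  CStarAlgebra.nonneg_iff_eq_star_mul_self.mp hA.nonneg

/-! ### Tensor products of families of matrices over different index types -/

section Tensor

variable {ι : Type} [Fintype ι] {E : ι → Type}

/-- The tensor product of a finite family of matrices, in the product basis. -/
def tens (A : ∀ i, Matrix (E i) (E i) ℂ) : Matrix (∀ i, E i) (∀ i, E i) ℂ :=
  Matrix.of fun a b => ∏ i, A i (a i) (b i)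

theorem tens_apply (A : ∀ i, Matrix (E i) (E i) ℂ) (a b : ∀ i, E i) :
    tens A a b = ∏ i, A i (a i) (b i) := rfl

theorem tens_smul (r : ι → ℂ) (A : ∀ i, Matrix (E i) (E i) ℂ) :
    tens (fun i => r i • A i) = (∏ i, r i) • tens A := by
  ext a b
  simp [tens_apply, Finset.prod_mul_distrib]

theorem tens_conjTranspose (A : ∀ i, Matrix (E i) (E i) ℂ) :
    (tens A)ᴴ = tens fun i => (A i)ᴴ := by
  ext a b
  simp [tens_apply, Matrix.conjTranspose_apply]

theorem tens_one [∀ i, DecidableEq (E i)] [DecidableEq (∀ i, E i)] :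
    tens (fun i => (1 : Matrix (E i) (E i) ℂ)) = 1 := by
  ext a b
  rw [tens_apply, Matrix.one_apply]
  split_ifs with h
  · subst h; simp
  · obtain ⟨i, hi⟩ := Function.ne_iff.mp h
    exact Finset.prod_eq_zero (Finset.mem_univ i) (Matrix.one_apply_ne hi)

variable [DecidableEq ι]

theorem tens_sum {Y : ι → Type} [∀ i, Fintype (Y i)] (A : ∀ i, Y i → Matrix (E i) (E i) ℂ) :
    ∑ y : ∀ i, Y i, tens (fun i => A i (y i)) = tens fun i => ∑ y, A i y := by
  ext a b
  simp only [tens_apply, Matrix.sum_apply]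
  rw [Fintype.prod_sum]

variable [∀ i, Fintype (E i)]

theorem tens_mul (A B : ∀ i, Matrix (E i) (E i) ℂ) :
    tens A * tens B = tens fun i => A i * B i := by
  ext a b
  simp only [tens_apply, Matrix.mul_apply]
  rw [Fintype.prod_sum]
  simp [Finset.prod_mul_distrib]

theorem tens_trace (A : ∀ i, Matrix (E i) (E i) ℂ) :
    (tens A).trace = ∏ i, (A i).trace := by
  simp only [Matrix.trace, Matrix.diag, tens_apply]
  rw [Fintype.prod_sum]

theorem tens_posSemidef [∀ i, DecidableEq (E i)] {A : ∀ i, Matrix (E i) (E i) ℂ}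
    (hA : ∀ i, (A i).PosSemidef) : (tens A).PosSemidef := by
  classical
  choose K hK using fun i => exists_eq_conjTranspose_mul_self (hA i)
  have : tens A = (tens K)ᴴ * tens K := by
    rw [tens_conjTranspose, tens_mul]
    congr 1
    exact funext hK
  rw [this]
  exact Matrix.posSemidef_conjTranspose_mul_self _

end Tensor

/-! ### Positivity of traces of products -/

section Trace

variable {D : Type} [Fintype D] [DecidableEq D]

theorem trace_mul_nonneg {σ A : Matrix D D ℂ} (hσ : σ.PosSemidef) (hA : A.PosSemidef) :
    0 ≤ (σ * A).trace := by
  obtain ⟨K, rfl⟩ := exists_eq_conjTranspose_mul_self hA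
  rw [← mul_assoc, Matrix.trace_mul_comm, ← mul_assoc]
  exact (hσ.mul_mul_conjTranspose_same K).trace_nonneg

theorem trace_mul_re_nonneg {σ A : Matrix D D ℂ} (hσ : σ.PosSemidef) (hA : A.PosSemidef) :
    0 ≤ (σ * A).trace.re :=
  (Complex.nonneg_iff.mp (trace_mul_nonneg hσ hA)).1

theorem trace_mul_eq_ofReal {σ A : Matrix D D ℂ} (hσ : σ.PosSemidef) (hA : A.PosSemidef) :
    (σ * A).trace = ((σ * A).trace.re : ℂ) :=
  Complex.ext rfl (Complex.nonneg_iff.mp (trace_mul_nonneg hσ hA)).2.symm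

end Trace

/-! ### From POVMs to algorithms -/

section Povm

variable {D O : Type} [Fintype D] [DecidableEq D]

/-- Every finite POVM with labelled outcomes is realized by an algorithm with one measurement. -/
theorem exists_algorithm_of_povm {Ω : Type} [Fintype Ω] (M : Ω → Matrix D D ℂ)
    (hM : ∀ ω, (M ω).PosSemidef) (hsum : ∑ ω, M ω = 1) (out : Ω → O) :
    ∃ alg : Algorithm D O, ∀ (S : Set O) (σ : Matrix D D ℂ),
      alg.prob S σ = ∑ ω, S.indicator (fun _ => (σ * M ω).trace.re) (out ω) := by
  classical
  choose K hK using fun ω => exists_eq_conjTranspose_mul_self (hM ω)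
  let e := (Fintype.equivFin Ω).symm
  refine ⟨.measure (Fintype.card Ω) (fun j => K (e j)) ?_ (fun j => .output (out (e j))), ?_⟩
  · rw [Equiv.sum_comp e fun ω => (K ω)ᴴ * K ω, ← hsum]
    exact Finset.sum_congr rfl fun ω _ => (hK ω).symm
  · intro S σ
    simp only [Algorithm.prob]
    rw [Equiv.sum_comp e fun ω => S.indicator (fun _ => (K ω * σ * (K ω)ᴴ).trace.re) (out ω)]
    refine Finset.sum_congr rfl fun ω _ => ?_
    rw [hK ω, ← mul_assoc σ, Matrix.trace_mul_comm (σ * (K ω)ᴴ), ← mul_assoc]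

end Povm

/-! ### Chernoff bounds -/

section Chernoff

variable {ι Ω : Type} [Fintype ι] [DecidableEq ι] [Fintype Ω]

/-- By independence the moment generating function factors. For `z ∈ [0, 1]` and `|v| ≤ 1`, `e^{vz}
≤ 1 + vz + (vz)² ≤ 1 + (v + v²) z`, which bounds each factor. -/
theorem sum_prod_exp_le {r Z : ι → Ω → ℝ} (hr : ∀ i ω, 0 ≤ r i ω) (hr1 : ∀ i, ∑ ω, r i ω = 1)
    (hZ0 : ∀ i ω, 0 ≤ Z i ω) (hZ1 : ∀ i ω, Z i ω ≤ 1) {v : ℝ} (hv : |v| ≤ 1) :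
    ∑ ω : ι → Ω, (∏ i, r i (ω i)) * Real.exp (v * ∑ i, Z i (ω i)) ≤
      Real.exp ((v + v ^ 2) * ∑ i, ∑ ω, r i ω * Z i ω) := by
  have h1 : ∀ ω : ι → Ω, (∏ i, r i (ω i)) * Real.exp (v * ∑ i, Z i (ω i)) =
      ∏ i, (r i (ω i) * Real.exp (v * Z i (ω i))) := fun ω => by
    rw [Finset.prod_mul_distrib, Finset.mul_sum, Real.exp_sum]
  simp_rw [h1]
  rw [← Fintype.prod_sum (f := fun i ω => r i ω * Real.exp (v * Z i ω)), Finset.mul_sum,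
    Real.exp_sum]
  refine Finset.prod_le_prod (fun i _ => Finset.sum_nonneg fun ω _ =>
    mul_nonneg (hr i ω) (Real.exp_pos _).le) fun i _ => ?_
  calc ∑ ω, r i ω * Real.exp (v * Z i ω)
      ≤ ∑ ω, (r i ω + (v + v ^ 2) * (r i ω * Z i ω)) := by
        refine Finset.sum_le_sum fun ω _ => ?_
        have hz : |v * Z i ω| ≤ 1 := by
          rw [abs_mul, abs_of_nonneg (hZ0 i ω)]
          exact mul_le_one₀ hv (hZ0 i ω) (hZ1 i ω)
        have h2 := (abs_le.mp (Real.abs_exp_sub_one_sub_id_le hz)).2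
        have h3 : Z i ω ^ 2 ≤ Z i ω := by nlinarith [hZ0 i ω, hZ1 i ω]
        have h4 : Real.exp (v * Z i ω) ≤ 1 + (v + v ^ 2) * Z i ω := by
          nlinarith [mul_le_mul_of_nonneg_left h3 (sq_nonneg v)]
        nlinarith [mul_le_mul_of_nonneg_left h4 (hr i ω)]
    _ = (v + v ^ 2) * ∑ ω, r i ω * Z i ω + 1 := by
        rw [Finset.sum_add_distrib, hr1, ← Finset.mul_sum, add_comm]
    _ ≤ _ := Real.add_one_le_exp _

/-- A Chernoff bound for a sum of independent variables with values in `[0, 1]`. -/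
theorem chernoff {r Z : ι → Ω → ℝ} (hr : ∀ i ω, 0 ≤ r i ω) (hr1 : ∀ i, ∑ ω, r i ω = 1)
    (hZ0 : ∀ i ω, 0 ≤ Z i ω) (hZ1 : ∀ i ω, Z i ω ≤ 1) {u : ℝ} (hu0 : 0 ≤ u) (hu : u ≤ 1)
    {μ t : ℝ} (hμ : ∑ i, ∑ ω, r i ω * Z i ω = μ) :
    ∑ ω : ι → Ω, (if t < |∑ i, Z i (ω i) - μ| then ∏ i, r i (ω i) else 0) ≤
      2 * Real.exp (-(u * t) + u ^ 2 * μ) := by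
  have hp := sum_prod_exp_le hr hr1 hZ0 hZ1 (v := u) (by rwa [abs_of_nonneg hu0])
  have hn := sum_prod_exp_le hr hr1 hZ0 hZ1 (v := -u) (by rwa [abs_neg, abs_of_nonneg hu0])
  rw [hμ] at hp hn
  -- The indicator of the two-sided deviation is dominated by the sum of the exponential weights of
  -- the two tails.
  have key : ∀ ω : ι → Ω, (if t < |∑ i, Z i (ω i) - μ| then ∏ i, r i (ω i) else 0) ≤
      Real.exp (-(u * t) - u * μ) * ((∏ i, r i (ω i)) * Real.exp (u * ∑ i, Z i (ω i))) +
      Real.exp (-(u * t) + u * μ) * ((∏ i, r i (ω i)) * Real.exp (-u * ∑ i, Z i (ω i))) := by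
    intro ω
    have hq : 0 ≤ ∏ i, r i (ω i) := Finset.prod_nonneg fun i _ => hr i _
    set q := ∏ i, r i (ω i)
    set s := ∑ i, Z i (ω i)
    have e1 : Real.exp (-(u * t) - u * μ) * (q * Real.exp (u * s)) =
        q * Real.exp (u * (s - μ - t)) := by
      rw [mul_left_comm, ← Real.exp_add]; ring_nf
    have e2 : Real.exp (-(u * t) + u * μ) * (q * Real.exp (-u * s)) =
        q * Real.exp (u * (-(s - μ) - t)) := by
      rw [mul_left_comm, ← Real.exp_add]; ring_nf
    rw [e1, e2]
    have p1 := mul_nonneg hq (Real.exp_pos (u * (s - μ - t))).le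
    have p2 := mul_nonneg hq (Real.exp_pos (u * (-(s - μ) - t))).le
    split_ifs with h
    · rcases lt_abs.mp h with h | h
      · have := Real.one_le_exp (x := u * (s - μ - t)) (mul_nonneg hu0 (by linarith))
        nlinarith [mul_le_mul_of_nonneg_left this hq]
      · have := Real.one_le_exp (x := u * (-(s - μ) - t)) (mul_nonneg hu0 (by linarith))
        nlinarith [mul_le_mul_of_nonneg_left this hq]
    · linarith
  refine (Finset.sum_le_sum fun ω _ => key ω).trans ?_
  rw [Finset.sum_add_distrib, ← Finset.mul_sum, ← Finset.mul_sum]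
  have a1 := mul_le_mul_of_nonneg_left hp (Real.exp_pos (-(u * t) - u * μ)).le
  have a2 := mul_le_mul_of_nonneg_left hn (Real.exp_pos (-(u * t) + u * μ)).le
  rw [← Real.exp_add] at a1 a2
  have b1 : -(u * t) - u * μ + (u + u ^ 2) * μ = -(u * t) + u ^ 2 * μ := by ring
  have b2 : -(u * t) + u * μ + (-u + (-u) ^ 2) * μ = -(u * t) + u ^ 2 * μ := by ring
  rw [b1] at a1
  rw [b2] at a2
  linarith

end Chernoff

/-! ### The gentle search and its failure probability -/

section GentleSearch

theorem posSemidef_conj_of_isHermitian {D : Type} [Fintype D] {A Y : Matrix D D ℂ} (hA : A.IsHermitian)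
    (hY : Y.PosSemidef) : (A * Y * A).PosSemidef := by
  have := hY.mul_mul_conjTranspose_same A
  rwa [hA.eq] at this

variable {D C : Type} [Fintype D] [DecidableEq D] [Fintype C]

/-- The POVM of the gentle search with `t` rounds. In each round a uniformly random `c` is tested
with the rejecting Kraus operator `1 - h c`; the search ends with `c` when the test accepts. After
the last round it returns `c₀`. -/
noncomputable def searchPovm [DecidableEq C] (h : C → Matrix D D ℂ) (c₀ : C) : ℕ → C → Matrix D D ℂ
  | 0, c => if c = c₀ then 1 else 0
  | t + 1, c => ((Fintype.card C : ℝ)⁻¹) • ((1 - (1 - h c) * (1 - h c)) +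
      ∑ c', (1 - h c') * searchPovm h c₀ t c * (1 - h c'))

theorem posSemidef_one_sub_one_sub_sq {h : Matrix D D ℂ} (h0 : h.PosSemidef)
    (h1 : (1 - h).PosSemidef) : (1 - (1 - h) * (1 - h)).PosSemidef := by
  have e : 1 - (1 - h) * (1 - h) = h + (h * (1 - h) * h + (1 - h) * h * (1 - h)) := by
    noncomm_ring
  rw [e]
  exact h0.add ((posSemidef_conj_of_isHermitian h0.1 h1).add
    (posSemidef_conj_of_isHermitian h1.1 h0))

variable [DecidableEq C] {h : C → Matrix D D ℂ} (c₀ : C)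

theorem searchPovm_posSemidef (h0 : ∀ c, (h c).PosSemidef) (h1 : ∀ c, (1 - h c).PosSemidef)
    (t : ℕ) (c : C) : (searchPovm h c₀ t c).PosSemidef := by
  induction t generalizing c with
  | zero =>
    simp only [searchPovm]
    split_ifs
    · exact Matrix.PosSemidef.one
    · exact Matrix.PosSemidef.zero
  | succ t ih =>
    simp only [searchPovm]
    refine Matrix.PosSemidef.smul ?_ (by positivity)
    exact (posSemidef_one_sub_one_sub_sq (h0 c) (h1 c)).add
      (Matrix.posSemidef_sum _ fun c' _ => posSemidef_conj_of_isHermitian (h1 c').1 (ih c))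

theorem searchPovm_succ_sum (t : ℕ) (S : Finset C) :
    ∑ c ∈ S, searchPovm h c₀ (t + 1) c =
      ((Fintype.card C : ℝ)⁻¹) • ((∑ c ∈ S, (1 - (1 - h c) * (1 - h c))) +
        ∑ c', (1 - h c') * (∑ c ∈ S, searchPovm h c₀ t c) * (1 - h c')) := by
  simp only [searchPovm]
  rw [← Finset.smul_sum, Finset.sum_add_distrib, Finset.sum_comm]
  simp only [Finset.mul_sum, Finset.sum_mul]

theorem searchPovm_sum (t : ℕ) : ∑ c, searchPovm h c₀ t c = 1 := by
  induction t with
  | zero => simp [searchPovm]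
  | succ t ih =>
    rw [searchPovm_succ_sum, ih, ← Finset.sum_add_distrib]
    have : Nonempty C := ⟨c₀⟩
    simp only [mul_one, sub_add_cancel, Finset.sum_const, Finset.card_univ]
    rw [← Nat.cast_smul_eq_nsmul ℝ, smul_smul, inv_mul_cancel₀ (by positivity), one_smul]

/-- Rejection by `h` moves the expectation of an effect by a fraction of the acceptance
probability. -/
theorem trace_reject_le {σ h Y : Matrix D D ℂ} (hσ : σ.PosSemidef) (hσ1 : σ.trace = 1)
    (h0 : h.PosSemidef) (hY0 : Y.PosSemidef) (hY1 : (1 - Y).PosSemidef) {x κ : ℝ}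
    (hx : (σ * h).trace = (x : ℂ)) (hx0 : 0 < x) (hx1 : x ≤ 1)
    (hvar : (σ * (h * h)).trace.re ≤ (1 + κ) * x ^ 2) :
    (σ * ((1 - h) * Y * (1 - h))).trace.re ≤ (1 - x) * (σ * Y).trace.re + x * κ := by
  have hr : ∀ (a : ℝ) (A : Matrix D D ℂ), (σ * (a • A)).trace.re = a * (σ * A).trace.re := by
    intro a A
    simp [Matrix.trace_smul]
  -- `B` is the centred, normalized `h`: its second moment in `σ` is the relative variance of `h`,
  -- at most `κ`.
  set B : Matrix D D ℂ := 1 - x⁻¹ • h with hB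
  have hBh : B.IsHermitian := by
    have : (x⁻¹ • h).IsHermitian := (h0.smul (by positivity : (0 : ℝ) ≤ x⁻¹)).1
    exact Matrix.isHermitian_one.sub this
  -- The difference is a nonnegative multiple of `h Y h`, so `(1 - h) Y (1 - h) ≤ (1 - x) Y + x B Y
  -- B` as operators. Since `Y ≤ 1`, the last term contributes at most `x` times the second moment
  -- of `B`.
  have e1 : (1 - x) • Y + x • (B * Y * B) - (1 - h) * Y * (1 - h) = (x⁻¹ - 1) • (h * Y * h) := by
    have hxx : x * (x⁻¹ * x⁻¹) = x⁻¹ := by field_simp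
    have hxi : x * x⁻¹ = 1 := by field_simp
    simp only [hB, sub_mul, mul_sub, one_mul, mul_one, smul_mul_assoc, mul_smul_comm, smul_sub,
      smul_smul, sub_smul, one_smul, hxx, hxi]
    abel
  have p1 := trace_mul_re_nonneg hσ (posSemidef_conj_of_isHermitian h0.1 hY0)
  have p2 := trace_mul_re_nonneg hσ (posSemidef_conj_of_isHermitian hBh hY1)
  have e2 : B * (1 - Y) * B = B * B - B * Y * B := by noncomm_ring
  have e3 : B * B = 1 - (2 * x⁻¹) • h + (x⁻¹ ^ 2) • (h * h) := by
    simp only [hB, sub_mul, mul_sub, one_mul, mul_one, smul_mul_assoc, mul_smul_comm,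
      smul_sub, smul_smul, two_mul, add_smul, sq]
    abel
  rw [e2, mul_sub, Matrix.trace_sub, Complex.sub_re, e3, mul_add, mul_sub, Matrix.trace_add,
    Matrix.trace_sub, Complex.add_re, Complex.sub_re, hr, hr, mul_one, hσ1, hx] at p2
  have e4 : (σ * _).trace.re = (σ * _).trace.re := congrArg (fun A => (σ * A).trace.re) e1
  rw [mul_sub, mul_add, Matrix.trace_sub, Matrix.trace_add, Complex.sub_re, Complex.add_re,
    hr, hr, hr] at e4
  have hxi : 0 ≤ x⁻¹ - 1 := by
    have := (one_le_inv₀ hx0).mpr hx1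
    linarith
  have p3 := mul_nonneg hxi p1
  have p4 : x⁻¹ ^ 2 * (σ * (h * h)).trace.re ≤ 1 + κ := by
    have := mul_le_mul_of_nonneg_left hvar (by positivity : 0 ≤ x⁻¹ ^ 2)
    have e : x⁻¹ ^ 2 * ((1 + κ) * x ^ 2) = 1 + κ := by field_simp
    linarith
  have e5 : 2 * x⁻¹ * x = 2 := by field_simp
  simp only [Complex.one_re, Complex.ofReal_re] at p2
  have p5 : (σ * (B * Y * B)).trace.re ≤ κ := by linarith
  have p6 := mul_le_mul_of_nonneg_left p5 hx0.le
  linarith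

/-- The gentle search returns an element of `S` with small probability, if `S` carries a small part
of the total acceptance weight. -/
theorem searchPovm_trace_le {σ : Matrix D D ℂ} (hσ : σ.PosSemidef) (hσ1 : σ.trace = 1)
    (h0 : ∀ c, (h c).PosSemidef) (h1 : ∀ c, (1 - h c).PosSemidef) {x : C → ℝ} {κ β r : ℝ}
    (hx : ∀ c, (σ * h c).trace = (x c : ℂ)) (hr0 : 0 < r) (hr : ∀ c, r ≤ x c)
    (hvar : ∀ c, (σ * (h c * h c)).trace.re ≤ (1 + κ) * x c ^ 2) (hκ : 0 ≤ κ) (hβ : 0 ≤ β)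
    {S : Finset C} (hS : ∑ c ∈ S, x c ≤ β * ∑ c, x c) (t : ℕ) :
    (σ * ∑ c ∈ S, searchPovm h c₀ t c).trace.re ≤ (1 - r) ^ t + (κ + 2 * β) := by
  have hC : Nonempty C := ⟨c₀⟩
  have hx0 : ∀ c, 0 < x c := fun c => hr0.trans_le (hr c)
  have hx1 : ∀ c, x c ≤ 1 := fun c => by
    have := trace_mul_re_nonneg hσ (h1 c)
    rw [mul_sub, Matrix.trace_sub, mul_one, hσ1, hx] at this
    simpa using this
  have hY1 : ∀ t, (1 - ∑ c ∈ S, searchPovm h c₀ t c).PosSemidef := fun t => by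
    have : 1 - ∑ c ∈ S, searchPovm h c₀ t c = ∑ c ∈ Sᶜ, searchPovm h c₀ t c := by
      rw [← searchPovm_sum (h := h) c₀ t, ← Finset.sum_add_sum_compl S, add_sub_cancel_left]
    rw [this]
    exact Matrix.posSemidef_sum _ fun c _ => searchPovm_posSemidef c₀ h0 h1 t c
  set N : ℝ := (Fintype.card C : ℝ) with hN
  have hN0 : 0 < N := by positivity
  -- `H` is the mean test weight. One more initial round turns `v` into at most `(1 - H) v + H (κ +
  -- 2β)`, a convex combination, so `κ + 2β` does not accumulate. The recursion peels off the first
  -- round, so all expectations are in the original `σ`.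
  set H : ℝ := N⁻¹ * ∑ c, x c with hH
  have hHr : r ≤ H := by
    have : N * r ≤ ∑ c, x c := by
      calc N * r = ∑ _c : C, r := by simp [hN]
        _ ≤ _ := Finset.sum_le_sum fun c _ => hr c
    rw [hH, inv_mul_eq_div, le_div_iff₀ hN0]
    linarith
  have hH1 : H ≤ 1 := by
    have : ∑ c, x c ≤ N := by
      calc ∑ c, x c ≤ ∑ _c : C, (1 : ℝ) := Finset.sum_le_sum fun c _ => hx1 c
        _ = N := by simp [hN]
    rw [hH, inv_mul_eq_div, div_le_iff₀ hN0]
    linarith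
  induction t with
  | zero =>
    have := trace_mul_re_nonneg hσ (hY1 0)
    rw [mul_sub, Matrix.trace_sub, mul_one, hσ1] at this
    simp only [Complex.sub_re, Complex.one_re] at this
    simp only [pow_zero]
    linarith
  | succ t ih =>
    rw [searchPovm_succ_sum]
    set Y := ∑ c ∈ S, searchPovm h c₀ t c with hY
    set v := (σ * Y).trace.re with hv
    have hY0 : Y.PosSemidef :=
      Matrix.posSemidef_sum _ fun c _ => searchPovm_posSemidef c₀ h0 h1 t c
    -- The acceptance effect `1 - (1 - h)² = 2h - h²` is at most `2h`, whence the factor 2 in front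
    -- of `β`.
    have a1 : ∀ c, (σ * (1 - (1 - h c) * (1 - h c))).trace.re ≤ 2 * x c := fun c => by
      have e : 1 - (1 - h c) * (1 - h c) = (2 : ℝ) • h c - h c * h c := by
        rw [two_smul]; noncomm_ring
      have hh := trace_mul_re_nonneg hσ
        (A := h c * 1 * h c) (posSemidef_conj_of_isHermitian (h0 c).1 Matrix.PosSemidef.one)
      rw [mul_one] at hh
      rw [e, mul_sub, Matrix.trace_sub, Complex.sub_re, mul_smul_comm, Matrix.trace_smul, hx]
      simp only [Complex.real_smul, Complex.re_ofReal_mul, Complex.ofReal_re]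
      linarith
    have a2 : ∀ c, (σ * ((1 - h c) * Y * (1 - h c))).trace.re ≤ (1 - x c) * v + x c * κ :=
      fun c => trace_reject_le hσ hσ1 (h0 c) hY0 (hY1 t) (hx c) (hx0 c) (hx1 c) (hvar c)
    have b1 : (σ * (N⁻¹ • ((∑ c ∈ S, (1 - (1 - h c) * (1 - h c))) +
        ∑ c', (1 - h c') * Y * (1 - h c')))).trace.re =
        N⁻¹ * ((∑ c ∈ S, (σ * (1 - (1 - h c) * (1 - h c))).trace.re) +
          ∑ c', (σ * ((1 - h c') * Y * (1 - h c'))).trace.re) := by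
      rw [mul_smul_comm, Matrix.trace_smul, mul_add, Matrix.trace_add, Finset.mul_sum,
        Finset.mul_sum, Matrix.trace_sum, Matrix.trace_sum]
      simp only [Complex.real_smul, Complex.re_ofReal_mul, Complex.add_re, Complex.re_sum]
    rw [b1]
    have b2 : (∑ c ∈ S, (σ * (1 - (1 - h c) * (1 - h c))).trace.re) ≤ 2 * (β * ∑ c, x c) := by
      calc _ ≤ ∑ c ∈ S, 2 * x c := Finset.sum_le_sum fun c _ => a1 c
        _ = 2 * ∑ c ∈ S, x c := by rw [Finset.mul_sum]
        _ ≤ _ := by linarith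
    have b3 : ∑ c', (σ * ((1 - h c') * Y * (1 - h c'))).trace.re ≤
        N * v - (∑ c, x c) * v + (∑ c, x c) * κ := by
      calc _ ≤ ∑ c, ((1 - x c) * v + x c * κ) := Finset.sum_le_sum fun c _ => a2 c
        _ = _ := by
          rw [Finset.sum_add_distrib, ← Finset.sum_mul, ← Finset.sum_mul, Finset.sum_sub_distrib]
          simp [hN]; ring
    have b4 := mul_le_mul_of_nonneg_left (add_le_add b2 b3) (inv_nonneg.mpr hN0.le)
    have b5 : N⁻¹ * (2 * (β * ∑ c, x c) + (N * v - (∑ c, x c) * v + (∑ c, x c) * κ)) =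
        (1 - H) * v + H * (κ + 2 * β) := by
      rw [hH]; field_simp; ring
    rw [b5] at b4
    refine b4.trans ?_
    have c1 := mul_le_mul_of_nonneg_left ih (by linarith : 0 ≤ 1 - H)
    have c2 : (1 - H) * (1 - r) ^ t ≤ (1 - r) * (1 - r) ^ t :=
      mul_le_mul_of_nonneg_right (by linarith) (pow_nonneg (by linarith) _)
    rw [pow_succ']
    linarith

end GentleSearch

/-! ### Measurements and soft projectors on one site -/

section Site

variable {d : ℕ}

theorem posSemidef_of_isStarProjection {P : Matrix (Fin d) (Fin d) ℂ} (hP : IsStarProjection P) :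
    P.PosSemidef := by
  have h1 : P * P = P := hP.isIdempotentElem
  have h2 : Pᴴ = P := hP.isSelfAdjoint
  have := Matrix.posSemidef_conjTranspose_mul_self P
  rwa [h2, h1] at this

/-- The projector for the outcome `y` of the measurement `{P, 1 - P}`. -/
def siteProj (P : Matrix (Fin d) (Fin d) ℂ) (y : Bool) : Matrix (Fin d) (Fin d) ℂ :=
  if y then P else 1 - P

theorem siteProj_posSemidef {P : Matrix (Fin d) (Fin d) ℂ} (hP : IsStarProjection P) (y : Bool) :
    (siteProj P y).PosSemidef := by
  cases y
  · exact posSemidef_of_isStarProjection hP.one_sub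
  · exact posSemidef_of_isStarProjection hP

theorem siteProj_sum (P : Matrix (Fin d) (Fin d) ℂ) : ∑ y, siteProj P y = 1 := by
  simp [siteProj]

/-- The probability `Tr[ρ P]` of the outcome `P`. -/
def siteProb (ρ P : Matrix (Fin d) (Fin d) ℂ) : ℝ := (ρ * P).trace.re

theorem trace_mul_siteProj {ρ P : Matrix (Fin d) (Fin d) ℂ} (hρ : IsDensity ρ)
    (hP : IsStarProjection P) (y : Bool) :
    (ρ * siteProj P y).trace = ((if y then siteProb ρ P else 1 - siteProb ρ P : ℝ) : ℂ) := by
  have h := trace_mul_eq_ofReal hρ.1 (posSemidef_of_isStarProjection hP)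
  cases y
  · simp [siteProj, mul_sub, hρ.2, siteProb, ← h]
  · simp [siteProj, siteProb, ← h]

theorem siteProb_nonneg {ρ P : Matrix (Fin d) (Fin d) ℂ} (hρ : IsDensity ρ)
    (hP : IsStarProjection P) : 0 ≤ siteProb ρ P :=
  trace_mul_re_nonneg hρ.1 (posSemidef_of_isStarProjection hP)

theorem siteProb_le_one {ρ P : Matrix (Fin d) (Fin d) ℂ} (hρ : IsDensity ρ)
    (hP : IsStarProjection P) : siteProb ρ P ≤ 1 := by
  have h := trace_mul_re_nonneg hρ.1 (siteProj_posSemidef hP false)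
  rw [trace_mul_siteProj hρ hP] at h
  simpa using h

/-- The operator `P + q (1 - P)`. -/
noncomputable def softProj (q : ℝ) (P : Matrix (Fin d) (Fin d) ℂ) : Matrix (Fin d) (Fin d) ℂ :=
  ∑ y, ((if y then 1 else q : ℝ) : ℂ) • siteProj P y

theorem softProj_mul_self (q : ℝ) {P : Matrix (Fin d) (Fin d) ℂ} (hP : IsStarProjection P) :
    softProj q P * softProj q P = softProj (q ^ 2) P := by
  have h1 : P * P = P := hP.isIdempotentElem
  have h2 : P * (1 - P) = 0 := by rw [mul_sub, h1, mul_one, sub_self]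
  have h3 : (1 - P) * P = 0 := by rw [sub_mul, h1, one_mul, sub_self]
  have h4 : (1 - P) * (1 - P) = 1 - P := by rw [mul_sub, h3, mul_one, sub_zero]
  simp [softProj, siteProj, add_mul, mul_add, h1, h2, h3, h4, smul_smul, sq]

theorem softProj_posSemidef {q : ℝ} (hq : 0 ≤ q) {P : Matrix (Fin d) (Fin d) ℂ}
    (hP : IsStarProjection P) : (softProj q P).PosSemidef := by
  refine Matrix.posSemidef_sum _ fun y _ => (siteProj_posSemidef hP y).smul ?_
  rw [Complex.zero_le_real]
  split_ifs <;> linarith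

theorem trace_mul_softProj (q : ℝ) {ρ P : Matrix (Fin d) (Fin d) ℂ} (hρ : IsDensity ρ)
    (hP : IsStarProjection P) :
    (ρ * softProj q P).trace = ((siteProb ρ P + q * (1 - siteProb ρ P) : ℝ) : ℂ) := by
  simp only [softProj, Fintype.sum_bool, mul_add, Matrix.trace_add, mul_smul_comm,
    Matrix.trace_smul, trace_mul_siteProj hρ hP]
  simp

end Site

/-! ### Soft projectors on product states -/

section Product

variable {d : ℕ} {ι : Type} [Fintype ι] [DecidableEq ι]

theorem tens_density {ρ : ι → Matrix (Fin d) (Fin d) ℂ} (hρ : ∀ i, IsDensity (ρ i)) :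
    (tens ρ).PosSemidef ∧ (tens ρ).trace = 1 :=
  ⟨tens_posSemidef fun i => (hρ i).1, by rw [tens_trace]; simp [(hρ _).2]⟩

/-- In the joint projective measurement of all sites, the tensor product is diagonal with weights `q
^ (number of rejections)` in `[0, 1]`. -/
theorem one_sub_tens_softProj_posSemidef {q : ℝ} (hq : 0 ≤ q) (hq1 : q ≤ 1)
    {P : ι → Matrix (Fin d) (Fin d) ℂ} (hP : ∀ i, IsStarProjection (P i)) :
    (1 - tens fun i => softProj q (P i)).PosSemidef := by
  have e1 : (tens fun i => softProj q (P i)) = ∑ y : ι → Bool,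
      (∏ i, ((if y i then 1 else q : ℝ) : ℂ)) • tens fun i => siteProj (P i) (y i) := by
    simp_rw [← tens_smul]
    exact (tens_sum fun i y => ((if y then 1 else q : ℝ) : ℂ) • siteProj (P i) y).symm
  have e2 : (1 : Matrix (ι → Fin d) (ι → Fin d) ℂ) =
      ∑ y : ι → Bool, tens fun i => siteProj (P i) (y i) := by
    rw [tens_sum (fun i y => siteProj (P i) y)]
    simp_rw [siteProj_sum]
    exact tens_one.symm
  rw [e1, e2, ← Finset.sum_sub_distrib]
  refine Matrix.posSemidef_sum _ fun y _ => ?_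
  have e3 : (tens fun i => siteProj (P i) (y i)) -
      (∏ i, ((if y i then 1 else q : ℝ) : ℂ)) • (tens fun i => siteProj (P i) (y i)) =
      ((1 - ∏ i, (if y i then 1 else q : ℝ) : ℝ) : ℂ) •
        tens fun i => siteProj (P i) (y i) := by
    rw [Complex.ofReal_sub, Complex.ofReal_prod, sub_smul, Complex.ofReal_one, one_smul]
  rw [e3]
  refine (tens_posSemidef fun i => siteProj_posSemidef (hP i) (y i)).smul ?_
  rw [Complex.zero_le_real, sub_nonneg]
  refine Finset.prod_le_one (fun i _ => ?_) fun i _ => ?_ <;> split_ifs <;> linarith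

theorem trace_tens_softProj (q : ℝ) {ρ P : ι → Matrix (Fin d) (Fin d) ℂ}
    (hρ : ∀ i, IsDensity (ρ i)) (hP : ∀ i, IsStarProjection (P i)) :
    (tens ρ * tens fun i => softProj q (P i)).trace =
      ((∏ i, (siteProb (ρ i) (P i) + q * (1 - siteProb (ρ i) (P i))) : ℝ) : ℂ) := by
  rw [tens_mul, tens_trace, Complex.ofReal_prod]
  exact Finset.prod_congr rfl fun i _ => trace_mul_softProj q (hρ i) (hP i)

end Product

/-! ### One-site estimates for mean and variance of the soft test -/

section Scalar

/-- Convexity of `exp` between `0` and `-u`. The product over sites bounds the weight of the best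
hypothesis from below. -/
theorem exp_le_soft {u t : ℝ} (h0 : 0 ≤ t) (h1 : t ≤ 1) :
    Real.exp (-(u * (1 - t))) ≤ t + Real.exp (-u) * (1 - t) := by
  have := convexOn_exp.2 (Set.mem_univ 0) (Set.mem_univ (-u)) h0 (by linarith : 0 ≤ 1 - t)
    (by ring)
  simp only [smul_eq_mul, mul_zero, zero_add, Real.exp_zero, mul_one] at this
  calc Real.exp (-(u * (1 - t))) = Real.exp ((1 - t) * -u) := by ring_nf
    _ ≤ _ := by linarith

/-- `(1 + u + u²/2) (1 - u + u²/2) = 1 + u⁴/4 ≥ 1`, and `1 + u + u²/2 ≤ e^u`. -/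
theorem exp_neg_le_quadratic {u : ℝ} (hu : 0 ≤ u) : Real.exp (-u) ≤ 1 - u + u ^ 2 / 2 := by
  have h := Real.quadratic_le_exp_of_nonneg hu
  rw [Real.exp_neg, inv_le_comm₀ (Real.exp_pos u) (by nlinarith [sq_nonneg (u - 1)])]
  refine le_trans ?_ h
  rw [inv_le_iff_one_le_mul₀ (by nlinarith [sq_nonneg (u - 1)])]
  nlinarith [sq_nonneg (u ^ 2)]

theorem soft_le_exp {u t : ℝ} (hu : 0 ≤ u) (h0 : 0 ≤ t) (h1 : t ≤ 1) :
    t + Real.exp (-u) * (1 - t) ≤ Real.exp (-(u * (1 - t)) + u ^ 2 / 2) := by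
  have h := mul_le_mul_of_nonneg_right (exp_neg_le_quadratic hu) (by linarith : 0 ≤ 1 - t)
  have h2 := Real.add_one_le_exp (-(u * (1 - t)) + u ^ 2 / 2)
  nlinarith [sq_nonneg u]

/-- With `q = e^{-u}`, the one-site variance is `t (1 - t) (1 - q)²`. Here `1 - q ≤ u`, and AM-GM
with `q ≥ 1/4` bounds `t (1 - t)` by the squared mean. Multiplied over the sites this gives the
relative variance `κ`. -/
theorem soft_sq_le {u t : ℝ} (hu : 0 ≤ u) (hu1 : u ≤ 1) (h0 : 0 ≤ t) (h1 : t ≤ 1) :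
    t + Real.exp (-u) ^ 2 * (1 - t) ≤
      Real.exp (u ^ 2) * (t + Real.exp (-u) * (1 - t)) ^ 2 := by
  set q := Real.exp (-u) with hq
  have hq0 : 1 - u ≤ q := by have := Real.add_one_le_exp (-u); linarith
  have hq1 : q ≤ 1 := Real.exp_le_one_iff.mpr (by linarith)
  have hq4 : 1 / 4 ≤ q := by
    have : Real.exp (-1) ≤ q := Real.exp_le_exp.mpr (by linarith)
    have h3 : Real.exp (-1) = (Real.exp 1)⁻¹ := Real.exp_neg 1
    have h4 : (4 : ℝ)⁻¹ ≤ (Real.exp 1)⁻¹ := by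
      gcongr
      have := Real.exp_one_lt_d9
      linarith
    linarith
  have h5 : (1 - q) ^ 2 ≤ u ^ 2 := by nlinarith
  have h6 : t * (1 - t) ≤ (t + q * (1 - t)) ^ 2 := by
    nlinarith [sq_nonneg (t - q * (1 - t)), mul_nonneg h0 (sub_nonneg.mpr h1)]
  have h7 : t + q ^ 2 * (1 - t) = (t + q * (1 - t)) ^ 2 + t * (1 - t) * (1 - q) ^ 2 := by ring
  have h8 : t * (1 - t) * (1 - q) ^ 2 ≤ (t + q * (1 - t)) ^ 2 * u ^ 2 :=
    mul_le_mul h6 h5 (sq_nonneg _) (sq_nonneg _)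
  have h9 := mul_le_mul_of_nonneg_right (Real.add_one_le_exp (u ^ 2))
    (sq_nonneg (t + q * (1 - t)))
  linarith

end Scalar

/-! ### Search on a product state -/

section Search

variable {d : ℕ} {ι C : Type} [Fintype ι] [DecidableEq ι] [Fintype C] [DecidableEq C] [Nonempty C]

/-- On every product of states, a search POVM returns some `c` with `∑ᵢ Tr[ρᵢ Pᵢ]` close to
maximal. -/
theorem exists_search_povm {P : C → ι → Matrix (Fin d) (Fin d) ℂ}
    (hP : ∀ c i, IsStarProjection (P c i)) {u : ℝ} (hu : 0 ≤ u) (hu1 : u ≤ 1) :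
    ∃ X : C → Matrix (ι → Fin d) (ι → Fin d) ℂ, (∀ c, (X c).PosSemidef) ∧ ∑ c, X c = 1 ∧
      ∀ ρ : ι → Matrix (Fin d) (Fin d) ℂ, (∀ i, IsDensity (ρ i)) → ∀ (S : Finset C) (c₁ : C)
        (Δ : ℝ), (∀ c ∈ S, ∑ i, siteProb (ρ i) (P c i) ≤ ∑ i, siteProb (ρ i) (P c₁ i) - Δ) →
        (tens ρ * ∑ c ∈ S, X c).trace.re ≤ 1 / 16 +
          ((Real.exp (Fintype.card ι * u ^ 2) - 1) + 2 * (Fintype.card C *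
            Real.exp (-(u * Δ) + Fintype.card ι * (u ^ 2 / 2)))) := by
  set q := Real.exp (-u) with hq
  set s : ℝ := (Fintype.card ι : ℝ) with hs
  have hq0 : 0 ≤ q := (Real.exp_pos _).le
  have hq1 : q ≤ 1 := Real.exp_le_one_iff.mpr (by linarith)
  set r := Real.exp (-(u * s)) with hr
  have hr0 : 0 < r := Real.exp_pos _
  -- The number of rounds may be exponential in the block size: the disturbance bound does not
  -- depend on it.
  obtain ⟨T, hT⟩ := exists_pow_lt_of_lt_one (by norm_num : (0 : ℝ) < 1 / 16)
    (by linarith : 1 - r < 1)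
  let c₀ : C := Classical.arbitrary C
  let h : C → Matrix (ι → Fin d) (ι → Fin d) ℂ := fun c => tens fun i => softProj q (P c i)
  have h0 : ∀ c, (h c).PosSemidef := fun c =>
    tens_posSemidef fun i => softProj_posSemidef hq0 (hP c i)
  have h1 : ∀ c, (1 - h c).PosSemidef := fun c =>
    one_sub_tens_softProj_posSemidef hq0 hq1 (hP c)
  refine ⟨searchPovm h c₀ T, searchPovm_posSemidef c₀ h0 h1 T, searchPovm_sum c₀ T, ?_⟩
  intro ρ hρ S c₁ Δ hS
  let τ : C → ι → ℝ := fun c i => siteProb (ρ i) (P c i)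
  have hτ0 : ∀ c i, 0 ≤ τ c i := fun c i => siteProb_nonneg (hρ i) (hP c i)
  have hτ1 : ∀ c i, τ c i ≤ 1 := fun c i => siteProb_le_one (hρ i) (hP c i)
  let x : C → ℝ := fun c => ∏ i, (τ c i + q * (1 - τ c i))
  have hx : ∀ c, (tens ρ * h c).trace = (x c : ℂ) := fun c => trace_tens_softProj q hρ (hP c)
  have hlow : ∀ c, Real.exp (-(u * (s - ∑ i, τ c i))) ≤ x c := fun c => by
    have : -(u * (s - ∑ i, τ c i)) = ∑ i, -(u * (1 - τ c i)) := by
      rw [Finset.sum_neg_distrib, ← Finset.mul_sum, Finset.sum_sub_distrib]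
      simp [hs]
    rw [this, Real.exp_sum]
    exact Finset.prod_le_prod (fun i _ => (Real.exp_pos _).le)
      fun i _ => exp_le_soft (hτ0 c i) (hτ1 c i)
  have hupp : ∀ c, x c ≤ Real.exp (-(u * (s - ∑ i, τ c i)) + s * (u ^ 2 / 2)) := fun c => by
    have : -(u * (s - ∑ i, τ c i)) + s * (u ^ 2 / 2) =
        ∑ i, (-(u * (1 - τ c i)) + u ^ 2 / 2) := by
      rw [Finset.sum_add_distrib, Finset.sum_neg_distrib, ← Finset.mul_sum,
        Finset.sum_sub_distrib]
      simp [hs]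
    rw [this, Real.exp_sum]
    exact Finset.prod_le_prod (fun i _ => add_nonneg (hτ0 c i)
      (mul_nonneg hq0 (by linarith [hτ1 c i]))) fun i _ => soft_le_exp hu (hτ0 c i) (hτ1 c i)
  have hxr : ∀ c, r ≤ x c := fun c => by
    refine le_trans (Real.exp_le_exp.mpr ?_) (hlow c)
    have := Finset.sum_nonneg fun i (_ : i ∈ Finset.univ) => hτ0 c i
    nlinarith
  have hx0 : ∀ c, 0 < x c := fun c => hr0.trans_le (hxr c)
  have hvar : ∀ c, (tens ρ * (h c * h c)).trace.re ≤
      (1 + (Real.exp (s * u ^ 2) - 1)) * x c ^ 2 := fun c => by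
    have e : h c * h c = tens fun i => softProj (q ^ 2) (P c i) := by
      simp only [h, tens_mul]
      congr 1
      exact funext fun i => softProj_mul_self q (hP c i)
    rw [e, trace_tens_softProj (q ^ 2) hρ (hP c), Complex.ofReal_re, add_sub_cancel,
      ← Finset.prod_pow]
    have e2 : Real.exp (s * u ^ 2) = ∏ _i : ι, Real.exp (u ^ 2) := by
      rw [Finset.prod_const, ← Real.exp_nat_mul, Finset.card_univ]
    rw [e2, ← Finset.prod_mul_distrib]
    exact Finset.prod_le_prod (fun i _ => add_nonneg (hτ0 c i)
      (mul_nonneg (sq_nonneg q) (by linarith [hτ1 c i])))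
      fun i _ => soft_sq_le hu hu1 (hτ0 c i) (hτ1 c i)
  have hκ : 0 ≤ Real.exp (s * u ^ 2) - 1 := by
    have := Real.one_le_exp (x := s * u ^ 2) (by positivity)
    linarith
  have hβ : 0 ≤ (Fintype.card C : ℝ) * Real.exp (-(u * Δ) + s * (u ^ 2 / 2)) := by positivity
  have hSx : ∑ c ∈ S, x c ≤
      (Fintype.card C * Real.exp (-(u * Δ) + s * (u ^ 2 / 2))) * ∑ c, x c := by
    -- Each bad weight is compared with the weight of `c₁` alone; the union over bad hypotheses
    -- costs the factor `Fintype.card C`.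
    have a1 : ∀ c ∈ S, x c ≤ Real.exp (-(u * Δ) + s * (u ^ 2 / 2)) * x c₁ := fun c hc => by
      refine (hupp c).trans (le_trans ?_ (mul_le_mul_of_nonneg_left (hlow c₁) (Real.exp_pos _).le))
      rw [← Real.exp_add]
      refine Real.exp_le_exp.mpr ?_
      have := mul_le_mul_of_nonneg_left (hS c hc) hu
      simp only [τ]
      linarith
    calc ∑ c ∈ S, x c ≤ ∑ _c ∈ S, Real.exp (-(u * Δ) + s * (u ^ 2 / 2)) * x c₁ :=
          Finset.sum_le_sum a1
      _ = S.card * (Real.exp (-(u * Δ) + s * (u ^ 2 / 2)) * x c₁) := by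
          rw [Finset.sum_const, nsmul_eq_mul]
      _ ≤ Fintype.card C * (Real.exp (-(u * Δ) + s * (u ^ 2 / 2)) * ∑ c, x c) := by
          refine mul_le_mul (by exact_mod_cast S.card_le_univ) ?_
            (mul_nonneg (Real.exp_pos _).le (hx0 c₁).le) (by positivity)
          exact mul_le_mul_of_nonneg_left
            (Finset.single_le_sum (fun c _ => (hx0 c).le) (Finset.mem_univ c₁))
            (Real.exp_pos _).le
      _ = _ := by ring
  have main := searchPovm_trace_le c₀ (tens_density hρ).1 (tens_density hρ).2 h0 h1 hx hr0 hxr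
    hvar hκ hβ hSx T
  linarith

end Search

open scoped Kronecker

/-! ### Search followed by verification on a fresh register -/

section Batch

variable {d : ℕ} {ι κ C : Type} [Fintype ι] [Fintype κ] [DecidableEq κ]

/-- Search on the first register, and then verification of the result on the second one. -/
def batchPovm (X : C → Matrix (ι → Fin d) (ι → Fin d) ℂ)
    (Q : C → κ → Matrix (Fin d) (Fin d) ℂ) (o : C × (κ → Bool)) :
    Matrix ((ι → Fin d) × (κ → Fin d)) ((ι → Fin d) × (κ → Fin d)) ℂ :=
  X o.1 ⊗ₖ tens fun k => siteProj (Q o.1 k) (o.2 k)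

variable {X : C → Matrix (ι → Fin d) (ι → Fin d) ℂ} {Q : C → κ → Matrix (Fin d) (Fin d) ℂ}

theorem batchPovm_posSemidef (hX : ∀ c, (X c).PosSemidef) (hQ : ∀ c k, IsStarProjection (Q c k))
    (o : C × (κ → Bool)) : (batchPovm X Q o).PosSemidef :=
  (hX o.1).kronecker (tens_posSemidef fun k => siteProj_posSemidef (hQ o.1 k) (o.2 k))

theorem sum_tens_siteProj (R : κ → Matrix (Fin d) (Fin d) ℂ) :
    ∑ y : κ → Bool, tens (fun k => siteProj (R k) (y k)) = 1 := by
  rw [tens_sum fun k y => siteProj (R k) y]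
  simp_rw [siteProj_sum]
  exact tens_one

theorem batchPovm_sum [Fintype C] (hX : ∑ c, X c = 1) : ∑ o, batchPovm X Q o = 1 := by
  rw [Fintype.sum_prod_type]
  have h1 : ∀ c, ∑ y : κ → Bool, batchPovm X Q (c, y) = X c ⊗ₖ 1 := fun c => by
    rw [← sum_tens_siteProj (Q c)]
    ext ⟨a, a'⟩ ⟨b, b'⟩
    simp only [batchPovm, Matrix.sum_apply, Matrix.kronecker_apply, Finset.mul_sum]
  simp_rw [h1]
  rw [← Matrix.one_kronecker_one, ← hX]
  ext ⟨a, a'⟩ ⟨b, b'⟩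
  simp only [Matrix.sum_apply, Matrix.kronecker_apply, Finset.sum_mul]

/-- The probability of the outcomes `y` of independent bits with biases `t`. -/
def bernProb (t : κ → ℝ) (y : κ → Bool) : ℝ := ∏ k, if y k then t k else 1 - t k

/-- The registers are in a product state, so given the returned hypothesis the verification bits are
fresh independent coins; the search does not bias them. -/
theorem trace_batchPovm [DecidableEq ι] {ρ : ι → Matrix (Fin d) (Fin d) ℂ} {ρ' : κ → Matrix (Fin d) (Fin d) ℂ}
    (hρ : ∀ i, IsDensity (ρ i)) (hρ' : ∀ k, IsDensity (ρ' k)) (hX : ∀ c, (X c).PosSemidef)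
    (hQ : ∀ c k, IsStarProjection (Q c k)) (o : C × (κ → Bool)) :
    ((tens ρ ⊗ₖ tens ρ') * batchPovm X Q o).trace.re =
      (tens ρ * X o.1).trace.re * bernProb (fun k => siteProb (ρ' k) (Q o.1 k)) o.2 := by
  rw [batchPovm, ← Matrix.mul_kronecker_mul, Matrix.trace_kronecker, tens_mul, tens_trace,
    trace_mul_eq_ofReal (tens_density hρ).1 (hX _)]
  simp_rw [trace_mul_siteProj (hρ' _) (hQ _ _)]
  rw [← Complex.ofReal_prod, ← Complex.ofReal_mul, Complex.ofReal_re]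
  rfl

theorem sum_bernProb (t : κ → ℝ) : ∑ y, bernProb t y = 1 := by
  simp only [bernProb]
  rw [← Fintype.prod_sum (f := fun k (y : Bool) => if y then t k else 1 - t k)]
  simp

theorem bernProb_chernoff {t : κ → ℝ} (h0 : ∀ k, 0 ≤ t k) (h1 : ∀ k, t k ≤ 1) {u : ℝ}
    (hu0 : 0 ≤ u) (hu : u ≤ 1) (x : ℝ) :
    ∑ y, (if x < |∑ k, (if y k then (1 : ℝ) else 0) - ∑ k, t k| then bernProb t y else 0) ≤
      2 * Real.exp (-(u * x) + u ^ 2 * Fintype.card κ) := by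
  have h := chernoff (ι := κ) (Ω := Bool) (r := fun k y => if y then t k else 1 - t k)
    (Z := fun _ y => if y then (1 : ℝ) else 0) (fun k y => by
      split_ifs
      · exact h0 k
      · linarith [h1 k]) (fun k => by simp) (fun k y => by split_ifs <;> norm_num)
    (fun k y => by split_ifs <;> norm_num) hu0 hu (μ := ∑ k, t k) (t := x)
    (by simp)
  refine h.trans ?_
  have : ∑ k, t k ≤ Fintype.card κ := by
    calc ∑ k, t k ≤ ∑ _k : κ, (1 : ℝ) := Finset.sum_le_sum fun k _ => h1 k
      _ = _ := by simp
  gcongr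

end Batch

/-! ### Union bounds for independent blocks -/

section ProductProbability

variable {β : Type} [Fintype β] [DecidableEq β] {Ω : β → Type} [∀ b, Fintype (Ω b)]
  {r : ∀ b, Ω b → ℝ}

/-- The indicator is absorbed into the factor at `b`, so that the sum factors; all other factors sum
to 1. -/
theorem sum_prod_marginal (hr1 : ∀ b, ∑ o, r b o = 1) (b : β) (p : Ω b → Prop)
    [DecidablePred p] :
    ∑ ω : ∀ b, Ω b, (if p (ω b) then ∏ b, r b (ω b) else 0) =
      ∑ o, if p o then r b o else 0 := by
  let g : ∀ b', Ω b' → ℝ := fun b' o =>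
    r b' o * if h : b' = b then (if p (h ▸ o) then 1 else 0) else 1
  have h1 : ∀ ω : ∀ b, Ω b, (if p (ω b) then ∏ b, r b (ω b) else 0) = ∏ b', g b' (ω b') := by
    intro ω
    simp only [g, Finset.prod_mul_distrib]
    rw [Finset.prod_eq_single (s := Finset.univ) (a := b) (f := fun b' =>
      if h : b' = b then (if p (h ▸ ω b') then (1 : ℝ) else 0) else 1)
      (fun b' _ hb => by simp [hb]) (fun h => absurd (Finset.mem_univ b) h)]
    simp
  simp_rw [h1]
  rw [← Fintype.prod_sum, Finset.prod_eq_single b]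
  · simp [g]
  · intro b' _ hb
    simp [g, hb, hr1]
  · exact fun h => absurd (Finset.mem_univ b) h

/-- Used with `p` for "the search fails" and `q` for "the verification is inaccurate": the first
must happen in every block and its probabilities multiply, the second in some block and its
probabilities add. -/
theorem sum_prod_forall_or_exists_le (hr0 : ∀ b o, 0 ≤ r b o) (hr1 : ∀ b, ∑ o, r b o = 1)
    (p q : ∀ b, Ω b → Prop) [∀ b, DecidablePred (p b)] [∀ b, DecidablePred (q b)]
    {F : (∀ b, Ω b) → Prop} [DecidablePred F]
    (hF : ∀ ω, F ω → (∀ b, p b (ω b)) ∨ ∃ b, q b (ω b)) :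
    ∑ ω : ∀ b, Ω b, (if F ω then ∏ b, r b (ω b) else 0) ≤
      (∏ b, ∑ o, if p b o then r b o else 0) + ∑ b, ∑ o, if q b o then r b o else 0 := by
  have h1 : ∀ ω : ∀ b, Ω b, (if F ω then ∏ b, r b (ω b) else 0) ≤
      (∏ b, if p b (ω b) then r b (ω b) else 0) +
        ∑ b, if q b (ω b) then ∏ b, r b (ω b) else 0 := by
    intro ω
    have n0 : 0 ≤ ∏ b, r b (ω b) := Finset.prod_nonneg fun b _ => hr0 b _
    have n1 : 0 ≤ ∏ b, if p b (ω b) then r b (ω b) else 0 :=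
      Finset.prod_nonneg fun b _ => by
        split_ifs
        · exact hr0 b _
        · exact le_rfl
    have n2 : ∀ b ∈ Finset.univ, 0 ≤ if q b (ω b) then ∏ b, r b (ω b) else 0 := fun b _ => by
      split_ifs
      · exact n0
      · exact le_rfl
    split_ifs with h
    · rcases hF ω h with h | ⟨b, h⟩
      · have : (∏ b, if p b (ω b) then r b (ω b) else 0) = ∏ b, r b (ω b) :=
          Finset.prod_congr rfl fun b _ => by simp [h b]
        rw [this]
        linarith [Finset.sum_nonneg n2]
      · have := Finset.single_le_sum n2 (Finset.mem_univ b)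
        rw [if_pos h] at this
        linarith
    · linarith [Finset.sum_nonneg n2]
  refine (Finset.sum_le_sum fun ω _ => h1 ω).trans ?_
  rw [Finset.sum_add_distrib, Finset.sum_comm,
    ← Fintype.prod_sum (f := fun b o => if p b o then r b o else 0)]
  refine add_le_add le_rfl (Finset.sum_le_sum fun b _ => ?_)
  exact (sum_prod_marginal hr1 b (q b)).le

end ProductProbability

/-! ### Splitting the system along a partition -/

section Partition

variable {n B : ℕ} (f : Fin n → Fin B × Bool)

/-- The indices in the block `g` of the partition `f`. -/
abbrev Block (g : Fin B × Bool) : Type := {i : Fin n // f i = g}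

/-- The splitting of a basis string of the whole system along a partition. -/
def splitBlocks (d : ℕ) : (Fin n → Fin d) ≃
    (∀ b : Fin B, (Block f (b, false) → Fin d) × (Block f (b, true) → Fin d)) where
  toFun a b := (fun i => a i, fun i => a i)
  -- The match is on a general block `g` with the membership proof as an argument, so that `f i` can
  -- later be replaced by a concrete pair.
  invFun x i := (show ∀ g : Fin B × Bool, Block f g → Fin d from fun
    | (b, false) => (x b).1
    | (b, true) => (x b).2) (f i) ⟨i, rfl⟩
  left_inv a := by
    funext i
    have : ∀ (g : Fin B × Bool) (h : f i = g), (show ∀ g : Fin B × Bool, Block f g → Fin d from fun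
        | (_, false) => fun i => a i
        | (_, true) => fun i => a i) g ⟨i, h⟩ = a i := by
      rintro ⟨b, _ | _⟩ h <;> rfl
    exact this (f i) rfl
  right_inv x := by
    have : ∀ (i : Fin n) (g : Fin B × Bool) (h : f i = g),
        (show ∀ g : Fin B × Bool, Block f g → Fin d from fun
          | (b, false) => (x b).1
          | (b, true) => (x b).2) (f i) ⟨i, rfl⟩ =
        (show ∀ g : Fin B × Bool, Block f g → Fin d from fun
          | (b, false) => (x b).1
          | (b, true) => (x b).2) g ⟨i, h⟩ := by
      intro i g h
      subst h
      rfl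
    funext b
    refine Prod.ext (funext fun i => ?_) (funext fun i => ?_)
    · exact this i.1 (b, false) i.2
    · exact this i.1 (b, true) i.2

theorem productState_eq_submatrix {d : ℕ} (ρ : Fin n → Matrix (Fin d) (Fin d) ℂ) :
    productState ρ = (tens fun b : Fin B => (tens fun i : Block f (b, false) => ρ i) ⊗ₖ
      (tens fun i : Block f (b, true) => ρ i)).submatrix
        (splitBlocks f d) (splitBlocks f d) := by
  ext a a'
  simp only [productState, Matrix.of_apply, Matrix.submatrix_apply, tens_apply,
    Matrix.kronecker_apply, splitBlocks, Equiv.coe_fn_mk]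
  rw [← Fintype.prod_fiberwise f, Fintype.prod_prod_type]
  simp [mul_comm]

variable {d : ℕ} {C : Type} [Fintype C] [DecidableEq C] [Nonempty C]

/-- Search and verification in the blocks of a fixed partition. -/
theorem exists_partition_povm {P : C → Fin n → Matrix (Fin d) (Fin d) ℂ}
    (hP : ∀ c i, IsStarProjection (P c i)) {u : ℝ} (hu : 0 ≤ u) (hu1 : u ≤ 1) :
    ∃ M : (∀ b : Fin B, C × (Block f (b, true) → Bool)) →
        Matrix (Fin n → Fin d) (Fin n → Fin d) ℂ,
      (∀ ω, (M ω).PosSemidef) ∧ ∑ ω, M ω = 1 ∧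
      ∀ ρ : Fin n → Matrix (Fin d) (Fin d) ℂ, (∀ i, IsDensity (ρ i)) →
        ∃ r : ∀ b : Fin B, C × (Block f (b, true) → Bool) → ℝ,
          (∀ b o, 0 ≤ r b o) ∧ (∀ b, ∑ o, r b o = 1) ∧
          (∀ ω, (productState ρ * M ω).trace.re = ∏ b, r b (ω b)) ∧
          (∀ b (S : Finset C) (c₁ : C) (Δ : ℝ),
            (∀ c ∈ S, ∑ i : Block f (b, false), siteProb (ρ i) (P c i) ≤
              ∑ i : Block f (b, false), siteProb (ρ i) (P c₁ i) - Δ) →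
            ∑ o, (if o.1 ∈ S then r b o else 0) ≤ 1 / 16 +
              ((Real.exp (Fintype.card (Block f (b, false)) * u ^ 2) - 1) + 2 * (Fintype.card C *
                Real.exp (-(u * Δ) + Fintype.card (Block f (b, false)) * (u ^ 2 / 2))))) ∧
          (∀ b (v x : ℝ), 0 ≤ v → v ≤ 1 →
            ∑ o, (if x < |∑ k, (if o.2 k then (1 : ℝ) else 0) -
                ∑ k : Block f (b, true), siteProb (ρ k) (P o.1 k)| then r b o else 0) ≤
              2 * Real.exp (-(v * x) + v ^ 2 * Fintype.card (Block f (b, true)))) := by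
  choose X hX hXsum hXρ using fun b : Fin B => exists_search_povm
    (P := fun c (i : Block f (b, false)) => P c i) (fun c i => hP c i) hu hu1
  let N : ∀ b : Fin B, C × (Block f (b, true) → Bool) →
      Matrix ((Block f (b, false) → Fin d) × (Block f (b, true) → Fin d))
        ((Block f (b, false) → Fin d) × (Block f (b, true) → Fin d)) ℂ := fun b =>
    batchPovm (X b) fun c (k : Block f (b, true)) => P c k
  have hN : ∀ b o, (N b o).PosSemidef := fun b o =>
    batchPovm_posSemidef (hX b) (fun c (k : Block f (b, true)) => hP c k) o
  refine ⟨fun ω => (tens fun b => N b (ω b)).submatrix (splitBlocks f d) (splitBlocks f d),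
    fun ω => (tens_posSemidef fun b => hN b (ω b)).submatrix _, ?_, ?_⟩
  · have h1 : ∑ ω : ∀ b : Fin B, C × (Block f (b, true) → Bool), tens (fun b => N b (ω b)) = 1 := by
      rw [tens_sum, funext fun b => batchPovm_sum (hXsum b)]
      exact tens_one
    have h2 := congrArg (fun A => A.submatrix (splitBlocks f d) (splitBlocks f d)) h1
    simp only [Matrix.submatrix_one_equiv] at h2
    rw [← h2]
    ext a a'
    simp [Matrix.sum_apply]
  · intro ρ hρ
    let σ : ∀ b : Fin B, Matrix ((Block f (b, false) → Fin d) × (Block f (b, true) → Fin d))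
        ((Block f (b, false) → Fin d) × (Block f (b, true) → Fin d)) ℂ := fun b => (tens fun i : Block f (b, false) => ρ i) ⊗ₖ
      (tens fun i : Block f (b, true) => ρ i)
    have hσ : ∀ b, (σ b).PosSemidef := fun b =>
      (tens_posSemidef fun i : Block f (b, false) => (hρ i).1).kronecker
        (tens_posSemidef fun i : Block f (b, true) => (hρ i).1)
    have hr : ∀ b o, (σ b * N b o).trace.re = ((tens fun i : Block f (b, false) => ρ i) *
        X b o.1).trace.re * bernProb (fun k : Block f (b, true) => siteProb (ρ k) (P o.1 k)) o.2 :=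
      fun b o => trace_batchPovm (fun i : Block f (b, false) => hρ i)
        (fun i : Block f (b, true) => hρ i) (hX b)
        (fun c (k : Block f (b, true)) => hP c k) o
    have hq0 : ∀ b c, 0 ≤ ((tens fun i : Block f (b, false) => ρ i) * X b c).trace.re :=
      fun b c => trace_mul_re_nonneg (tens_posSemidef fun i => (hρ i).1) (hX b c)
    have hq1 : ∀ b, ∑ c, ((tens fun i : Block f (b, false) => ρ i) * X b c).trace.re = 1 := by
      intro b
      rw [← Complex.re_sum, ← Matrix.trace_sum, ← Finset.mul_sum, hXsum, mul_one,
        (tens_density fun i : Block f (b, false) => hρ i).2, Complex.one_re]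
    refine ⟨fun b o => (σ b * N b o).trace.re, fun b o => trace_mul_re_nonneg (hσ b) (hN b o),
      ?_, ?_, ?_, ?_⟩
    · intro b
      simp_rw [hr]
      rw [Fintype.sum_prod_type]
      simp only [← Finset.mul_sum, sum_bernProb, mul_one]
      exact hq1 b
    · intro ω
      rw [productState_eq_submatrix f ρ, Matrix.submatrix_mul_equiv, tens_mul]
      have : ∀ A : Matrix (∀ b : Fin B, (Block f (b, false) → Fin d) × (Block f (b, true) → Fin d))
          _ ℂ, (A.submatrix (splitBlocks f d) (splitBlocks f d)).trace = A.trace := fun A =>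
        Equiv.sum_comp (splitBlocks f d) fun i => A i i
      rw [this, tens_trace]
      have h3 : ∀ b, (σ b * N b (ω b)).trace = ((σ b * N b (ω b)).trace.re : ℂ) :=
        fun b => trace_mul_eq_ofReal (hσ b) (hN b _)
      rw [Finset.prod_congr rfl fun b _ => h3 b, ← Complex.ofReal_prod, Complex.ofReal_re]
    · intro b S c₁ Δ hS
      refine le_of_eq_of_le ?_ (hXρ b (fun i => ρ i) (fun i => hρ i) S c₁ Δ hS)
      simp_rw [hr]
      rw [Fintype.sum_prod_type, Finset.mul_sum, Matrix.trace_sum, Complex.re_sum,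
        -- Only the outcomes with `c ∈ S` survive; their verification bits then sum out to 1.
        ← Finset.sum_filter_add_sum_filter_not Finset.univ (· ∈ S)]
      rw [Finset.sum_eq_zero (s := Finset.univ.filter fun c => c ∉ S) fun c hc => by
        simp [(Finset.mem_filter.mp hc).2], add_zero, Finset.filter_univ_mem]
      refine Finset.sum_congr rfl fun c hc => ?_
      simp only [hc, if_true]
      rw [← Finset.mul_sum, sum_bernProb, mul_one]
    · intro b v x hv0 hv1
      simp_rw [hr]
      rw [Fintype.sum_prod_type]
      have h4 : ∀ c, ∑ y : Block f (b, true) → Bool, (if x < |∑ k, (if y k then (1 : ℝ) else 0) -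
          ∑ k : Block f (b, true), siteProb (ρ k) (P c k)| then
            ((tens fun i : Block f (b, false) => ρ i) * X b c).trace.re *
              bernProb (fun k : Block f (b, true) => siteProb (ρ k) (P c k)) y else 0) ≤
          ((tens fun i : Block f (b, false) => ρ i) * X b c).trace.re *
            (2 * Real.exp (-(v * x) + v ^ 2 * Fintype.card (Block f (b, true)))) := fun c => by
        refine le_trans (le_of_eq ?_) (mul_le_mul_of_nonneg_left (bernProb_chernoff
          (t := fun k : Block f (b, true) => siteProb (ρ k) (P c k))
          (fun k => siteProb_nonneg (hρ k) (hP c k)) (fun k => siteProb_le_one (hρ k) (hP c k))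
          hv0 hv1 x) (hq0 b c))
        rw [Finset.mul_sum]
        exact Finset.sum_congr rfl fun y _ => (mul_ite_zero _ _ _).symm
      refine (Finset.sum_le_sum fun c _ => h4 c).trans ?_
      rw [← Finset.sum_mul, hq1, one_mul]

end Partition

/-! ### The tilted mean is close to the mean -/

section Tilted

/-- Jensen, via the tangent line at the mean, gives one side. For the other, the exponential is
expanded about the midpoint `1/2`, where `e^x ≤ 1 + x + x²` has an error of at most `γ²/4`. Division
by `γ` leaves `|γ| / 4`. -/
theorem abs_tilted_mean_sub_le {n : ℕ} (hn : 0 < n) {γ : ℝ} (hγ0 : γ ≠ 0) (hγ : |γ| ≤ 1)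
    {t : Fin n → ℝ} (h0 : ∀ i, 0 ≤ t i) (h1 : ∀ i, t i ≤ 1) :
    |1 / γ * Real.log (1 / (n : ℝ) * ∑ i, Real.exp (γ * t i)) - (∑ i, t i) / n| ≤ |γ| / 4 := by
  have hn' : (0 : ℝ) < n := by exact_mod_cast hn
  set p := (∑ i, t i) / n with hp
  have hsum : ∑ i, t i = n * p := by
    rw [hp, mul_div_assoc', mul_div_cancel_left₀ _ hn'.ne']
  set a := 1 / (n : ℝ) * ∑ i, Real.exp (γ * t i) with ha
  have hna : ∑ i, Real.exp (γ * t i) = n * a := by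
    rw [ha, one_div, mul_inv_cancel_left₀ hn'.ne']
  have hlow : Real.exp (γ * p) ≤ a := by
    have : ∑ i, Real.exp (γ * p) * (1 + γ * (t i - p)) ≤ ∑ i, Real.exp (γ * t i) := by
      refine Finset.sum_le_sum fun i _ => ?_
      have e : Real.exp (γ * t i) = Real.exp (γ * p) * Real.exp (γ * (t i - p)) := by
        rw [← Real.exp_add]; ring_nf
      rw [e]
      have := Real.add_one_le_exp (γ * (t i - p))
      exact mul_le_mul_of_nonneg_left (by linarith) (Real.exp_pos _).le
    rw [← Finset.mul_sum, Finset.sum_add_distrib, ← Finset.mul_sum, Finset.sum_sub_distrib, hsum,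
      hna] at this
    simp only [Finset.sum_const, Finset.card_univ, Fintype.card_fin, nsmul_eq_mul, mul_one,
      sub_self, mul_zero, add_zero] at this
    rw [mul_comm] at this
    exact le_of_mul_le_mul_left this hn'
  have hupp : a ≤ Real.exp (γ * p + γ ^ 2 / 4) := by
    have : ∑ i, Real.exp (γ * t i) ≤
        ∑ i, Real.exp (γ / 2) * ((1 - γ / 2 + γ ^ 2 / 4) + γ * t i) := by
      refine Finset.sum_le_sum fun i _ => ?_
      have e : Real.exp (γ * t i) = Real.exp (γ / 2) * Real.exp (γ * (t i - 1 / 2)) := by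
        rw [← Real.exp_add]; ring_nf
      rw [e]
      have hh : |t i - 1 / 2| ≤ 1 / 2 := abs_le.mpr ⟨by linarith [h0 i], by linarith [h1 i]⟩
      have hx : |γ * (t i - 1 / 2)| ≤ 1 := by
        rw [abs_mul]
        nlinarith [abs_nonneg γ, abs_nonneg (t i - 1 / 2)]
      have hx2 : (γ * (t i - 1 / 2)) ^ 2 ≤ γ ^ 2 / 4 := by
        rw [mul_pow]
        nlinarith [mul_nonneg (h0 i) (sub_nonneg.mpr (h1 i)), sq_nonneg γ]
      have := (abs_le.mp (Real.abs_exp_sub_one_sub_id_le hx)).2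
      exact mul_le_mul_of_nonneg_left (by linarith) (Real.exp_pos _).le
    rw [← Finset.mul_sum, Finset.sum_add_distrib, ← Finset.mul_sum, hsum, hna] at this
    simp only [Finset.sum_const, Finset.card_univ, Fintype.card_fin, nsmul_eq_mul] at this
    have h2 : a ≤ Real.exp (γ / 2) * (1 - γ / 2 + γ ^ 2 / 4 + γ * p) := by
      refine le_of_mul_le_mul_left (this.trans (le_of_eq ?_)) hn'
      ring
    refine h2.trans ?_
    have h3 := Real.add_one_le_exp (γ * p - γ / 2 + γ ^ 2 / 4)
    have e : Real.exp (γ * p + γ ^ 2 / 4) =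
        Real.exp (γ / 2) * Real.exp (γ * p - γ / 2 + γ ^ 2 / 4) := by
      rw [← Real.exp_add]; ring_nf
    rw [e]
    exact mul_le_mul_of_nonneg_left (by linarith) (Real.exp_pos _).le
  have ha0 : 0 < a := (Real.exp_pos _).trans_le hlow
  have l1 : γ * p ≤ Real.log a := (Real.le_log_iff_exp_le ha0).mpr hlow
  have l2 : Real.log a ≤ γ * p + γ ^ 2 / 4 := (Real.log_le_iff_le_exp ha0).mpr hupp
  have e : 1 / γ * Real.log a - p = (Real.log a - γ * p) / γ := by field_simp
  have hγp : 0 < |γ| := abs_pos.mpr hγ0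
  rw [e, abs_div, div_le_iff₀ hγp, abs_of_nonneg (by linarith)]
  have : |γ| * |γ| = γ ^ 2 := by rw [← sq, sq_abs]
  nlinarith

end Tilted

/-! ### Balanced partitions, and accuracy of the reported block -/

section Final

variable {n B m d : ℕ}

/-- The values `x` are spread over the blocks of `f` evenly, up to `η` in each block. -/
def IsBalanced (f : Fin n → Fin B × Bool) (x : Fin n → ℝ) (η : ℝ) : Prop :=
  ∀ g, |∑ i, (if f i = g then x i else 0) - (∑ i, x i) / (2 * B)| ≤ η

theorem sum_block_eq (f : Fin n → Fin B × Bool) (x : Fin n → ℝ) (g : Fin B × Bool) :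
    ∑ i : Block f g, x i = ∑ i, if f i = g then x i else 0 := by
  rw [← Finset.sum_filter]
  exact (Finset.sum_subtype (Finset.univ.filter fun i => f i = g) (by simp) x).symm

open Classical in
/-- A uniformly random partition is balanced with high probability. -/
theorem sum_not_isBalanced_le (hB : 0 < B) {x : Fin n → ℝ} (h0 : ∀ i, 0 ≤ x i)
    (h1 : ∀ i, x i ≤ 1) {a : ℝ} (ha0 : 0 ≤ a) (ha1 : a ≤ 1) :
    ∑ f : Fin n → Fin B × Bool,
      (if ¬ IsBalanced f x (a * (n / (2 * B))) then ((2 * B : ℝ)⁻¹) ^ n else 0) ≤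
      2 * B * (2 * Real.exp (-(a ^ 2 * (n / (2 * B)) / 4))) := by
  have hB' : (0 : ℝ) < B := by exact_mod_cast hB
  set w : ℝ := n / (2 * B) with hw
  have hone : ∀ g : Fin B × Bool, ∑ f : Fin n → Fin B × Bool,
      (if a * w < |∑ i, (if f i = g then x i else 0) - (∑ i, x i) / (2 * B)| then
        ((2 * B : ℝ)⁻¹) ^ n else 0) ≤ 2 * Real.exp (-(a ^ 2 * w / 4)) := by
    intro g
    have h := chernoff (ι := Fin n) (Ω := Fin B × Bool) (r := fun _ _ => (2 * B : ℝ)⁻¹)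
      (Z := fun i g' => if g' = g then x i else 0) (fun _ _ => by positivity)
      (fun _ => by
        simp only [Finset.sum_const, Finset.card_univ, Fintype.card_prod, Fintype.card_fin,
          Fintype.card_bool, nsmul_eq_mul, Nat.cast_mul, Nat.cast_ofNat]
        field_simp)
      (fun i g' => by
        split_ifs
        · exact h0 i
        · exact le_rfl)
      (fun i g' => by
        split_ifs
        · exact h1 i
        · exact zero_le_one) (u := a / 2) (by linarith) (by linarith)
      (μ := (∑ i, x i) / (2 * B)) (t := a * w)
      (by simp [div_eq_inv_mul, Finset.mul_sum])
    simp only [Finset.prod_const, Finset.card_univ, Fintype.card_fin] at h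
    refine h.trans ?_
    have hμ : (∑ i, x i) / (2 * B) ≤ w := by
      rw [hw]
      have : ∑ i, x i ≤ n := by
        calc ∑ i, x i ≤ ∑ _i : Fin n, (1 : ℝ) := Finset.sum_le_sum fun i _ => h1 i
          _ = n := by simp
      gcongr
    -- With `u = a / 2` the exponent is at most `-a² w / 2 + a² w / 4`.
    have : -(a / 2 * (a * w)) + (a / 2) ^ 2 * ((∑ i, x i) / (2 * B)) ≤ -(a ^ 2 * w / 4) := by
      have := mul_le_mul_of_nonneg_left hμ (sq_nonneg (a / 2))
      linarith
    gcongr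
  have hle : ∀ f : Fin n → Fin B × Bool,
      (if ¬ IsBalanced f x (a * w) then ((2 * B : ℝ)⁻¹) ^ n else 0) ≤
      ∑ g, (if a * w < |∑ i, (if f i = g then x i else 0) - (∑ i, x i) / (2 * B)| then
        ((2 * B : ℝ)⁻¹) ^ n else 0) := by
    intro f
    have hnn : ∀ g ∈ Finset.univ, 0 ≤
        (if a * w < |∑ i, (if f i = g then x i else 0) - (∑ i, x i) / (2 * B)| then
          ((2 * B : ℝ)⁻¹) ^ n else 0) := fun g _ => by split_ifs <;> positivity
    by_cases h : IsBalanced f x (a * w)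
    · rw [if_neg (not_not_intro h)]
      exact Finset.sum_nonneg hnn
    · rw [if_pos h]
      obtain ⟨g, hg⟩ := not_forall.mp h
      have := Finset.single_le_sum hnn (Finset.mem_univ g)
      rwa [if_pos (not_le.mp hg)] at this
  refine (Finset.sum_le_sum fun f _ => hle f).trans ?_
  rw [Finset.sum_comm]
  refine (Finset.sum_le_sum fun g _ => hone g).trans (le_of_eq ?_)
  simp only [Finset.sum_const, Finset.card_univ, Fintype.card_prod, Fintype.card_fin,
    Fintype.card_bool, nsmul_eq_mul, Nat.cast_mul, Nat.cast_ofNat]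
  ring

/-- The outcome of a run is reported by the block with the largest verified value. -/
theorem exists_best_block (hB : 0 < B) {f : Fin n → Fin B × Bool} (w : ℝ)
    (ω : ∀ b : Fin B, Fin m × (Block f (b, true) → Bool)) :
    ∃ o : Fin m × ℝ, ∃ b, o = ((ω b).1, (∑ k, if (ω b).2 k then (1 : ℝ) else 0) / w) ∧
      ∀ b', (∑ k, if (ω b').2 k then (1 : ℝ) else 0) / w ≤ o.2 := by
  have : Nonempty (Fin B) := ⟨⟨0, hB⟩⟩
  obtain ⟨b, hb⟩ := Finite.exists_max fun b : Fin B =>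
    (∑ k, if (ω b).2 k then (1 : ℝ) else 0) / w
  exact ⟨_, b, rfl, hb⟩

/-- The choice `u = 1 / (8 √w)` makes `s u² ≤ 1/32`, so the disturbance is at most `1/16`, while `uΔ
= a √w / 4 ≥ log k + 3` cancels the factor `k`. The total is at most `1/16 + 1/16 + 2/14 < 0.36 ≤
1/e`. -/
theorem search_failure_le {a w s Δ : ℝ} {k : ℕ} (hk : 0 < k) (hw : 0 < w) (hs : s ≤ 2 * w)
    (hΔ : Δ = 2 * a * w) (h : 4 * (Real.log k + 3) ≤ a * √w) :
    1 / 16 + ((Real.exp (s * (8 * √w)⁻¹ ^ 2) - 1) + 2 * (k *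
      Real.exp (-((8 * √w)⁻¹ * Δ) + s * ((8 * √w)⁻¹ ^ 2 / 2)))) ≤ Real.exp (-1) := by
  have hsq : √w ^ 2 = w := Real.sq_sqrt hw.le
  have hw' : 0 < √w := Real.sqrt_pos.mpr hw
  have hk' : (0 : ℝ) < k := by exact_mod_cast hk
  have e1 : s * (8 * √w)⁻¹ ^ 2 ≤ 1 / 32 := by
    rw [inv_pow, mul_pow, hsq, ← div_eq_mul_inv, div_le_iff₀ (by positivity)]
    linarith
  have e2 : (8 * √w)⁻¹ * Δ = a * √w / 4 := by
    rw [hΔ]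
    nth_rewrite 2 [← hsq]
    field_simp
    ring
  have e3 : k * Real.exp (-((8 * √w)⁻¹ * Δ) + s * ((8 * √w)⁻¹ ^ 2 / 2)) ≤
      Real.exp (-(3 - 1 / 64)) := by
    calc _ ≤ k * Real.exp (-Real.log k + -(3 - 1 / 64)) := by
          refine mul_le_mul_of_nonneg_left (Real.exp_le_exp.mpr ?_) hk'.le
          linarith
      _ = _ := by
          rw [Real.exp_add, Real.exp_neg (Real.log k), Real.exp_log hk', ← mul_assoc,
            mul_inv_cancel₀ hk'.ne', one_mul]
  have e4 : Real.exp (1 / 32 : ℝ) ≤ 1 + 1 / 16 := by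
    have := (abs_le.mp (Real.abs_exp_sub_one_sub_id_le (x := 1 / 32) (by norm_num [abs_le]))).2
    norm_num at this ⊢
    linarith
  have e5 : Real.exp (s * (8 * √w)⁻¹ ^ 2) ≤ Real.exp (1 / 32) := Real.exp_le_exp.mpr e1
  have g1 := Real.exp_one_gt_d9
  have g2 := Real.exp_one_lt_d9
  have e6 : Real.exp (-(3 - 1 / 64)) ≤ 1 / 14 := by
    have h1 : Real.exp (-(3 - 1 / 64)) ≤ Real.exp (-2.75 : ℝ) :=
      Real.exp_le_exp.mpr (by norm_num)
    have h2 : Real.exp (-2.75 : ℝ) ^ 4 = (Real.exp 1 ^ 11)⁻¹ := by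
      rw [← Real.exp_nat_mul, ← Real.exp_nat_mul, ← Real.exp_neg]; norm_num
    have h3 : (Real.exp 1 ^ 11)⁻¹ ≤ (1 / 14 : ℝ) ^ 4 := by
      rw [inv_le_comm₀ (by positivity) (by positivity)]
      calc ((1 / 14 : ℝ) ^ 4)⁻¹ ≤ 2.7182818283 ^ 11 := by norm_num
        _ ≤ _ := by gcongr
    have h4 : Real.exp (-2.75 : ℝ) ≤ 1 / 14 :=
      le_of_pow_le_pow_left₀ (by norm_num) (by norm_num) (h2 ▸ h3)
    exact h1.trans h4
  have e7 : (0.36 : ℝ) ≤ Real.exp (-1) := by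
    rw [Real.exp_neg, le_inv_comm₀ (by norm_num) (Real.exp_pos 1)]
    norm_num
    linarith
  norm_num at e7
  linarith

/-- If all verified values are accurate and some block finds a near-maximizer, the reported outcome
is accurate. -/
theorem best_block_accurate {f : Fin n → Fin B × Bool} {w ε : ℝ}
    {p μ : Fin m → ℝ} (hμ : ∀ c, |μ c - p c| ≤ ε / 4) {c₁ : Fin m} (hc₁ : ∀ c, p c ≤ p c₁)
    (hε : 0 < ε) {ω : ∀ b : Fin B, Fin m × (Block f (b, true) → Bool)} {o : Fin m × ℝ}
    (ho : ∃ b, o = ((ω b).1, (∑ k, if (ω b).2 k then (1 : ℝ) else 0) / w) ∧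
      ∀ b', (∑ k, if (ω b').2 k then (1 : ℝ) else 0) / w ≤ o.2)
    {b₀ : Fin B} (hb₀ : p c₁ - ε / 4 ≤ p (ω b₀).1)
    (hv : ∀ b, |(∑ k, if (ω b).2 k then (1 : ℝ) else 0) / w - p (ω b).1| ≤ ε / 8) :
    |o.2 - ⨆ c, μ c| < ε ∧ |o.2 - μ o.1| < ε := by
  obtain ⟨b, rfl, hb⟩ := ho
  have v1 := abs_le.mp (hv b)
  have v0 := abs_le.mp (hv b₀)
  have hb0 := hb b₀
  have hne : Nonempty (Fin m) := ⟨c₁⟩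
  have s1 : μ c₁ ≤ ⨆ c, μ c := le_ciSup (Set.finite_range μ).bddAbove c₁
  have s2 : ⨆ c, μ c ≤ p c₁ + ε / 4 := ciSup_le fun c => by
    have := (abs_le.mp (hμ c)).2
    linarith [hc₁ c]
  have m1 := (abs_le.mp (hμ c₁)).1
  have m2 := abs_le.mp (hμ (ω b).1)
  have q1 := hc₁ (ω b).1
  simp only at hb0 ⊢
  exact ⟨abs_lt.mpr ⟨by linarith, by linarith⟩, abs_lt.mpr ⟨by linarith [m2.1], by linarith [m2.2]⟩⟩

end Final

/-! ### The algorithm for `ε ≤ 1/2` and its sample size -/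

section Main

variable {n B m d : ℕ}

open Classical in
/-- The outcome of search and verification in the blocks of a balanced partition is accurate with
high probability. -/
theorem partition_failure_le (hn : 0 < n) (hB : 0 < B) (hm : 0 < m) {ε : ℝ} (hε : 0 < ε)
    (hε1 : ε ≤ 1) {w : ℝ} (hw : w = n / (2 * B)) (hbig : 4 * (Real.log m + 3) ≤ ε / 16 * √w)
    (f : Fin n → Fin B × Bool) {t : Fin m → Fin n → ℝ}
    (h1 : IsBalanced f (fun _ => 1) (ε / 16 * w)) (ht : ∀ c, IsBalanced f (t c) (ε / 16 * w))
    {r : ∀ b : Fin B, Fin m × (Block f (b, true) → Bool) → ℝ} (hr0 : ∀ b o, 0 ≤ r b o)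
    (hr1 : ∀ b, ∑ o, r b o = 1)
    (hsearch : ∀ b (S : Finset (Fin m)) (c₁ : Fin m) (Δ : ℝ),
      (∀ c ∈ S, ∑ i : Block f (b, false), t c i ≤ ∑ i : Block f (b, false), t c₁ i - Δ) →
      ∑ o, (if o.1 ∈ S then r b o else 0) ≤ 1 / 16 +
        ((Real.exp (Fintype.card (Block f (b, false)) * (8 * √w)⁻¹ ^ 2) - 1) + 2 *
          (Fintype.card (Fin m) * Real.exp (-((8 * √w)⁻¹ * Δ) +
            Fintype.card (Block f (b, false)) * ((8 * √w)⁻¹ ^ 2 / 2)))))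
    (hverify : ∀ b (v x : ℝ), 0 ≤ v → v ≤ 1 →
      ∑ o, (if x < |∑ k, (if o.2 k then (1 : ℝ) else 0) -
          ∑ k : Block f (b, true), t o.1 k| then r b o else 0) ≤
        2 * Real.exp (-(v * x) + v ^ 2 * Fintype.card (Block f (b, true))))
    {μ : Fin m → ℝ} (hμ : ∀ c, |μ c - (∑ i, t c i) / n| ≤ ε / 4)
    {out : (∀ b : Fin B, Fin m × (Block f (b, true) → Bool)) → Fin m × ℝ}
    (hout : ∀ ω, ∃ b, out ω = ((ω b).1, (∑ k, if (ω b).2 k then (1 : ℝ) else 0) / w) ∧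
      ∀ b', (∑ k, if (ω b').2 k then (1 : ℝ) else 0) / w ≤ (out ω).2) :
    ∑ ω, (if ε ≤ |(out ω).2 - ⨆ c, μ c| ∨ ε ≤ |(out ω).2 - μ (out ω).1| then
      ∏ b, r b (ω b) else 0) ≤
        Real.exp (-B) + B * (2 * Real.exp (-((ε / 16) ^ 2 * w / 8))) := by
  have hn' : (0 : ℝ) < n := by exact_mod_cast hn
  have hB' : (0 : ℝ) < B := by exact_mod_cast hB
  have hw0 : 0 < w := by rw [hw]; positivity
  set a := ε / 16 with ha
  have hne : Nonempty (Fin m) := ⟨⟨0, hm⟩⟩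
  let p : Fin m → ℝ := fun c => (∑ i, t c i) / n
  obtain ⟨c₁, hc₁⟩ := Finite.exists_max p
  have hpw : ∀ c, (∑ i, t c i) / (2 * B) = p c * w := fun c => by
    simp only [p, hw]
    field_simp
  have hblock : ∀ c g, |∑ i : Block f g, t c i - p c * w| ≤ a * w := fun c g => by
    rw [sum_block_eq, ← hpw]
    exact ht c g
  have hcard : ∀ g, (Fintype.card (Block f g) : ℝ) ≤ 2 * w := fun g => by
    have h := (abs_le.mp (h1 g)).2
    rw [← sum_block_eq f (fun _ => 1) g] at h
    simp only [Finset.sum_const, Finset.card_univ, nsmul_eq_mul, mul_one, Fintype.card_fin,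
      ← hw] at h
    nlinarith
  let S : Finset (Fin m) := Finset.univ.filter fun c => p c < p c₁ - ε / 4
  have hp : ∀ b, ∑ o, (if o.1 ∈ S then r b o else 0) ≤ Real.exp (-1) := by
    intro b
    -- A mean gap above `ε / 4 = 4a` gives a gap above `4aw` in expected block sums; balance may
    -- cost `aw` for each of the two hypotheses.
    refine (hsearch b S c₁ (2 * a * w) fun c hc => ?_).trans ?_
    · have e1 := (abs_le.mp (hblock c (b, false))).2
      have e2 := (abs_le.mp (hblock c₁ (b, false))).1
      have e3 : p c < p c₁ - ε / 4 := (Finset.mem_filter.mp hc).2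
      nlinarith
    · rw [Fintype.card_fin]
      exact search_failure_le hm hw0 (hcard _) rfl hbig
  have hq : ∀ b, ∑ o, (if a * w < |∑ k, (if o.2 k then (1 : ℝ) else 0) -
      ∑ k : Block f (b, true), t o.1 k| then r b o else 0) ≤
      2 * Real.exp (-(a ^ 2 * w / 8)) := by
    intro b
    -- With `v = a / 4` and at most `2w` sites, the exponent is at most `-a² w / 4 + a² w / 8`.
    refine (hverify b (a / 4) (a * w) (by positivity) (by linarith)).trans ?_
    have := mul_le_mul_of_nonneg_left (hcard (b, true)) (sq_nonneg (a / 4))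
    refine mul_le_mul_of_nonneg_left (Real.exp_le_exp.mpr ?_) zero_le_two
    linarith
  refine (sum_prod_forall_or_exists_le hr0 hr1 (fun _ o => o.1 ∈ S)
    (fun b o => a * w < |∑ k, (if o.2 k then (1 : ℝ) else 0) -
      ∑ k : Block f (b, true), t o.1 k|) ?_).trans ?_
  · intro ω hω
    by_contra hcon
    push Not at hcon
    obtain ⟨⟨b₀, hb₀⟩, hv⟩ := hcon
    have hb₀' : p c₁ - ε / 4 ≤ p (ω b₀).1 := by
      simpa [S] using hb₀
    have hv' : ∀ b, |(∑ k, if (ω b).2 k then (1 : ℝ) else 0) / w - p (ω b).1| ≤ ε / 8 := by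
      intro b
      have e1 := abs_le.mp (hv b)
      have e2 := abs_le.mp (hblock (ω b).1 (b, true))
      have e : (∑ k, if (ω b).2 k then (1 : ℝ) else 0) / w - p (ω b).1 =
          ((∑ k, if (ω b).2 k then (1 : ℝ) else 0) - p (ω b).1 * w) / w := by
        field_simp
      have haw : a * w = ε / 16 * w := by rw [ha]
      rw [e, abs_div, abs_of_pos hw0, div_le_iff₀ hw0]
      exact abs_le.mpr ⟨by linarith [e1.1, e2.1], by linarith [e1.2, e2.2]⟩
    obtain ⟨g1, g2⟩ := best_block_accurate hμ hc₁ hε (hout ω) hb₀' hv'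
    rcases hω with h | h
    · exact absurd h (not_le.mpr g1)
    · exact absurd h (not_le.mpr g2)
  · refine add_le_add ?_ ?_
    · calc _ ≤ ∏ _b : Fin B, Real.exp (-1) := Finset.prod_le_prod (fun b _ =>
            Finset.sum_nonneg fun o _ => by
              split_ifs
              · exact hr0 b o
              · exact le_rfl) fun b _ => hp b
        _ = Real.exp (-B) := by
            rw [Finset.prod_const, ← Real.exp_nat_mul]
            simp
    · calc _ ≤ ∑ _b : Fin B, 2 * Real.exp (-(a ^ 2 * w / 8)) := Finset.sum_le_sum fun b _ => hq b
        _ = _ := by simp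

/-- Search and verification in `B` pairs of random blocks. -/
theorem exists_algorithm_of_blocks (hn : 0 < n) (hB : 0 < B) (hm : 0 < m) {ε δ : ℝ} (hε : 0 < ε)
    (hε1 : ε ≤ 1) {w : ℝ} (hw : w = n / (2 * B)) (hbig : 4 * (Real.log m + 3) ≤ ε / 16 * √w)
    (hδ1 : Real.exp (-B) ≤ δ / 2)
    (hδ2 : 10 * B * m * Real.exp (-((ε / 16) ^ 2 * w / 8)) ≤ δ / 2)
    {P : Fin m → Fin n → Matrix (Fin d) (Fin d) ℂ} (hP : ∀ c i, IsStarProjection (P c i)) :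
    ∃ alg : Algorithm (Fin n → Fin d) (Fin m × ℝ),
      ∀ ρ : Fin n → Matrix (Fin d) (Fin d) ℂ, (∀ i, IsDensity (ρ i)) →
        ∀ μ : Fin m → ℝ, (∀ c, |μ c - (∑ i, siteProb (ρ i) (P c i)) / n| ≤ ε / 4) →
          alg.prob {o | ε ≤ |o.2 - ⨆ c, μ c| ∨ ε ≤ |o.2 - μ o.1|} (productState ρ) ≤ δ := by
  classical
  have hn' : (0 : ℝ) < n := by exact_mod_cast hn
  have hB' : (0 : ℝ) < B := by exact_mod_cast hB
  have hm1 : (1 : ℝ) ≤ m := by exact_mod_cast hm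
  have hw0 : 0 < w := by rw [hw]; positivity
  have hne : Nonempty (Fin m) := ⟨⟨0, hm⟩⟩
  have hu1 : (8 * √w)⁻¹ ≤ 1 := by
    refine inv_le_one_of_one_le₀ ?_
    have h1 := Real.log_nonneg hm1
    have h2 : ε / 16 * √w ≤ 1 * √w :=
      mul_le_mul_of_nonneg_right (by linarith) (Real.sqrt_nonneg w)
    linarith
  choose M hM hMsum hMρ using fun f : Fin n → Fin B × Bool =>
    exists_partition_povm f hP (u := (8 * √w)⁻¹) (by positivity) hu1
  choose out hout using fun f : Fin n → Fin B × Bool => exists_best_block (m := m) (f := f) hB w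
  set N : ℝ := ((2 * B : ℝ)⁻¹) ^ n with hN
  have hN0 : 0 ≤ N := by positivity
  have hNsum : ∑ _f : Fin n → Fin B × Bool, N = 1 := by
    simp only [Finset.sum_const, Finset.card_univ, Fintype.card_pi_const, Fintype.card_prod,
      Fintype.card_fin, Fintype.card_bool, nsmul_eq_mul, hN]
    push_cast
    rw [← mul_pow]
    have : ((B : ℝ) * 2) * (2 * (B : ℝ))⁻¹ = 1 := by field_simp
    rw [this, one_pow]
  -- The random partition is part of the measurement outcome: the POVMs of all partitions are
  -- combined with the uniform weight `N`.
  obtain ⟨alg, halg⟩ := exists_algorithm_of_povm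
    (Ω := Σ f : Fin n → Fin B × Bool, ∀ b : Fin B, Fin m × (Block f (b, true) → Bool))
    (fun ω => N • M ω.1 ω.2) (fun ω => (hM ω.1 ω.2).smul hN0)
    (by
      rw [Fintype.sum_sigma]
      have : ∀ f, ∑ ω, N • M f ω = N • (1 : Matrix (Fin n → Fin d) (Fin n → Fin d) ℂ) :=
        fun f => by rw [← Finset.smul_sum, hMsum]
      simp_rw [this]
      rw [← Finset.sum_smul, hNsum, one_smul])
    (fun ω => out ω.1 ω.2)
  refine ⟨alg, fun ρ hρ μ hμ => ?_⟩
  rw [halg, Fintype.sum_sigma]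
  let t : Fin m → Fin n → ℝ := fun c i => siteProb (ρ i) (P c i)
  -- `none` stands for the constant function 1, whose balance controls the block sizes; hence `m +
  -- 1` balance conditions.
  let Good : (Fin n → Fin B × Bool) → Option (Fin m) → Prop := fun f c =>
    IsBalanced f (c.elim (fun _ => 1) t) (ε / 16 * (n / (2 * B)))
  set E := Real.exp (-B) + B * (2 * Real.exp (-((ε / 16) ^ 2 * w / 8))) with hE
  have hE0 : 0 ≤ E := by positivity
  have hf : ∀ f : Fin n → Fin B × Bool,
      ∑ ω : (∀ b : Fin B, Fin m × (Block f (b, true) → Bool)),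
        ({o : Fin m × ℝ | ε ≤ |o.2 - ⨆ c, μ c| ∨ ε ≤ |o.2 - μ o.1|}).indicator
          (fun _ => (productState ρ * N • M f ω).trace.re) (out f ω) ≤
      (∑ c, if ¬ Good f c then N else 0) + N * E := by
    intro f
    obtain ⟨r, hr0, hr1, hr, hsearch, hverify⟩ := hMρ f ρ hρ
    have e1 : ∀ ω : (∀ b : Fin B, Fin m × (Block f (b, true) → Bool)),
        ({o : Fin m × ℝ | ε ≤ |o.2 - ⨆ c, μ c| ∨ ε ≤ |o.2 - μ o.1|}).indicator
          (fun _ => (productState ρ * N • M f ω).trace.re) (out f ω) =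
        N * (if ε ≤ |(out f ω).2 - ⨆ c, μ c| ∨ ε ≤ |(out f ω).2 - μ (out f ω).1| then
          ∏ b, r b (ω b) else 0) := by
      intro ω
      rw [Set.indicator_apply, mul_ite, mul_zero, ← hr, mul_smul_comm, Matrix.trace_smul]
      simp
    simp_rw [e1]
    rw [← Finset.mul_sum]
    have hnn : ∀ c ∈ Finset.univ, 0 ≤ if ¬ Good f c then N else 0 := fun c _ => by
      split_ifs
      · exact le_rfl
      · exact hN0
    -- An unbalanced partition is charged its whole weight `N`; a balanced one only `N * E`.
    by_cases hG : ∀ c, Good f c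
    · have g1 : IsBalanced f (fun _ => 1) (ε / 16 * w) := hw ▸ hG none
      have g2 : ∀ c, IsBalanced f (t c) (ε / 16 * w) := fun c => hw ▸ hG (some c)
      have := mul_le_mul_of_nonneg_left (partition_failure_le hn hB hm hε hε1 hw hbig f g1 g2
        hr0 hr1 hsearch hverify hμ (hout f)) hN0
      linarith [Finset.sum_nonneg hnn]
    · obtain ⟨c, hc⟩ := not_forall.mp hG
      have h2 := Finset.single_le_sum hnn (Finset.mem_univ c)
      rw [if_pos hc] at h2
      have h3 : ∑ ω : (∀ b : Fin B, Fin m × (Block f (b, true) → Bool)),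
          (if ε ≤ |(out f ω).2 - ⨆ c, μ c| ∨ ε ≤ |(out f ω).2 - μ (out f ω).1| then
            ∏ b, r b (ω b) else 0) ≤ 1 := by
        calc _ ≤ ∑ ω : (∀ b : Fin B, Fin m × (Block f (b, true) → Bool)), ∏ b, r b (ω b) := by
              refine Finset.sum_le_sum fun ω _ => ?_
              split_ifs
              · exact le_rfl
              · exact Finset.prod_nonneg fun b _ => hr0 b _
          _ = 1 := by
              rw [← Fintype.prod_sum]
              simp [hr1]
      have h4 := mul_le_mul_of_nonneg_left h3 hN0
      linarith [mul_nonneg hN0 hE0]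
  refine (Finset.sum_le_sum fun f _ => hf f).trans ?_
  rw [Finset.sum_add_distrib, ← Finset.sum_mul, hNsum, one_mul, Finset.sum_comm]
  have hc : ∀ c : Option (Fin m), ∑ f, (if ¬ Good f c then N else 0) ≤
      2 * B * (2 * Real.exp (-((ε / 16) ^ 2 * w / 4))) := fun c => by
    have hx : (∀ i, 0 ≤ c.elim (fun _ => (1 : ℝ)) t i) ∧
        ∀ i, c.elim (fun _ => (1 : ℝ)) t i ≤ 1 := by
      cases c with
      | none => exact ⟨fun _ => zero_le_one, fun _ => le_rfl⟩
      | some c => exact ⟨fun i => siteProb_nonneg (hρ i) (hP c i),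
          fun i => siteProb_le_one (hρ i) (hP c i)⟩
    rw [hw]
    exact sum_not_isBalanced_le hB hx.1 hx.2 (by positivity) (by linarith)
  have hsum := Finset.sum_le_sum fun c (_ : c ∈ Finset.univ) => hc c
  rw [Finset.sum_const, Finset.card_univ, Fintype.card_option, Fintype.card_fin,
    nsmul_eq_mul] at hsum
  push_cast at hsum
  set X := Real.exp (-((ε / 16) ^ 2 * w / 8)) with hX
  have hX0 : 0 < X := Real.exp_pos _
  have hX4 : Real.exp (-((ε / 16) ^ 2 * w / 4)) ≤ X := Real.exp_le_exp.mpr (by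
    have : 0 ≤ (ε / 16) ^ 2 * w := by positivity
    linarith)
  have h5 : (m + 1 : ℝ) * (2 * B * (2 * Real.exp (-((ε / 16) ^ 2 * w / 4)))) ≤
      (m + 1) * (2 * B * (2 * X)) := by gcongr
  -- Balance costs `4B (m + 1) X` and verification `2B X`, together at most `10 B m X`.
  have h6 : B * X ≤ B * X * m := le_mul_of_one_le_right (by positivity) hm1
  linarith

set_option maxHeartbeats 400000 in
/-- The sample size of the statement provides blocks that are large enough. -/
theorem blocks_large_of_sampleSize {ε δ γ : ℝ} (hm : 1 ≤ m) (hε : 0 < ε) (hε1 : ε ≤ 1 / 2)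
    (hδ : 0 < δ) (hδ1 : δ ≤ 1 / 2) (hγ : 0 < |γ|)
    (hN : 1000000 * sampleSize 3 m ε δ γ ≤ (n : ℝ)) :
    ∃ B : ℕ, 0 < n ∧ 0 < B ∧ 4 * (Real.log m + 3) ≤ ε / 16 * √((n : ℝ) / (2 * B)) ∧
      Real.exp (-B) ≤ δ / 2 ∧
      10 * B * m * Real.exp (-((ε / 16) ^ 2 * ((n : ℝ) / (2 * B)) / 8)) ≤ δ / 2 := by
  have hm1 : (1 : ℝ) ≤ m := by exact_mod_cast hm
  have hlm := Real.log_nonneg hm1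
  have l2 := Real.log_two_gt_d9
  have l2' := Real.log_two_lt_d9
  set ℓ := Real.log (1 / δ) with hℓ
  set L := Real.log (1 / ε) with hL
  have hℓ2 : Real.log 2 ≤ ℓ := Real.log_le_log two_pos (by
    rw [le_div_iff₀ hδ]; linarith)
  have hL2 : Real.log 2 ≤ L := Real.log_le_log two_pos (by
    rw [le_div_iff₀ hε]; linarith)
  have hℓ0 : 0 < ℓ := by linarith
  -- The factor `log² (1/ε)` is only needed to be bounded below, which is where `ε ≤ 1/2` enters.
  have hLL : 0.48 ≤ L ^ 2 := by nlinarith only [hL2, l2]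
  set Q := max ((Real.exp |γ| - 1) ^ 2 / γ ^ 2 * Real.log ((m : ℝ) / δ * ℓ * L ^ 2))
    ((Real.log m + 3) ^ 2) with hQ
  have hQ1 : (Real.log m + 3) ^ 2 ≤ Q := le_max_right _ _
  have hQ0 : 0 ≤ Q := (sq_nonneg _).trans hQ1
  -- The prefactor `(e^{|γ|} - 1)² / γ²` is at least 1. A negative logarithm is harmless because `Q
  -- ≥ 0`.
  have hQ2 : Real.log ((m : ℝ) / δ * ℓ * L ^ 2) ≤ Q := by
    by_cases h : 0 ≤ Real.log ((m : ℝ) / δ * ℓ * L ^ 2)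
    · refine le_trans ?_ (le_max_left _ _)
      refine le_mul_of_one_le_left h ?_
      rw [← sq_abs γ, one_le_div (by positivity)]
      have := Real.add_one_le_exp |γ|
      exact pow_le_pow_left₀ hγ.le (by linarith) 2
    · linarith
  have hlog : Real.log ((m : ℝ) / δ * ℓ * L ^ 2) = Real.log m + ℓ + Real.log (ℓ * L ^ 2) := by
    have : (m : ℝ) / δ * ℓ * L ^ 2 = m * (1 / δ) * (ℓ * L ^ 2) := by ring
    rw [this, Real.log_mul (by positivity) (by positivity), Real.log_mul (by positivity)
      (by positivity)]
  have hlog2 : -2 * Real.log 2 ≤ Real.log (ℓ * L ^ 2) := by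
    have h4 : Real.log (1 / 4) = -2 * Real.log 2 := by
      rw [show (1 / 4 : ℝ) = (2 ^ 2)⁻¹ by norm_num, Real.log_inv, Real.log_pow]
      push_cast; ring
    rw [← h4]
    refine Real.log_le_log (by norm_num) ?_
    nlinarith only [hLL, hℓ2, l2]
  have hQpos : 9 ≤ Q := by nlinarith only [hlm, hQ1]
  have hQ3 : Real.log m + ℓ + 7 ≤ 2 * Q := by linarith
  -- The least number of pairs with `e^{-B} ≤ δ / 2`.
  set B := ⌈ℓ + Real.log 2⌉₊ with hB
  have hB1 : ℓ + Real.log 2 ≤ B := Nat.le_ceil _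
  have hB2 : (B : ℝ) < ℓ + Real.log 2 + 1 := Nat.ceil_lt_add_one (by linarith)
  have hB5 : (B : ℝ) ≤ 5 * ℓ := by linarith
  have hB0 : (0 : ℝ) < B := by linarith
  have hε2 : 0 < ε ^ 2 := by positivity
  have hnQ : 480000 * ℓ * Q ≤ n * ε ^ 2 := by
    have h1 : 1000000 * sampleSize 3 m ε δ γ * ε ^ 2 = 1000000 * ℓ * L ^ 2 * Q := by
      rw [sampleSize]
      field_simp
      simp only [hQ, hℓ, hL]
      ring_nf
    have h2 := mul_le_mul_of_nonneg_right hN hε2.le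
    rw [h1] at h2
    have h3 := mul_le_mul_of_nonneg_left hLL (mul_nonneg hℓ0.le hQ0)
    linarith
  have hn : (0 : ℝ) < n := by
    have : 0 < n * ε ^ 2 := lt_of_lt_of_le (by positivity) hnQ
    exact pos_of_mul_pos_left this hε2.le
  set w : ℝ := (n : ℝ) / (2 * B) with hw
  have hw0 : 0 < w := by positivity
  have hwQ : 48000 * Q ≤ w * ε ^ 2 := by
    have h1 : n = w * (2 * B) := by rw [hw]; field_simp
    rw [h1] at hnQ
    have h2 : w * (2 * B) * ε ^ 2 ≤ w * ε ^ 2 * (10 * ℓ) := by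
      have : w * ε ^ 2 * (2 * B) ≤ w * ε ^ 2 * (10 * ℓ) :=
        mul_le_mul_of_nonneg_left (by linarith) (by positivity)
      linarith
    have h3 : (48000 * Q) * (10 * ℓ) ≤ w * ε ^ 2 * (10 * ℓ) := by linarith
    exact le_of_mul_le_mul_right h3 (by positivity)
  refine ⟨B, by exact_mod_cast hn, by exact_mod_cast hB0, ?_, ?_, ?_⟩
  · have h1 : (64 * (Real.log m + 3)) ^ 2 ≤ (ε * √w) ^ 2 := by
      rw [mul_pow ε, Real.sq_sqrt hw0.le, mul_pow]
      linarith
    have h2 := le_of_pow_le_pow_left₀ two_ne_zero (by positivity) h1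
    linarith
  · have : δ / 2 = Real.exp (-(ℓ + Real.log 2)) := by
      rw [neg_add, Real.exp_add, Real.exp_neg, Real.exp_neg, Real.exp_log two_pos, hℓ,
        Real.exp_log (by positivity)]
      field_simp
    rw [this]
    exact Real.exp_le_exp.mpr (by linarith)
  · have h1 : (B : ℝ) ≤ 5 * (1 / δ) := by
      have := Real.log_le_sub_one_of_pos (by positivity : 0 < 1 / δ)
      linarith
    -- One of the two `ℓ` absorbs the factor `B ≤ 5 / δ`, the other yields the final `δ`; `log m`
    -- pays for the union over hypotheses and `7` for the constants.
    have h2 : Real.exp (-((ε / 16) ^ 2 * w / 8)) ≤ Real.exp (-(Real.log m + 2 * ℓ + 7)) := by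
      refine Real.exp_le_exp.mpr ?_
      linarith
    have h3 : Real.exp (-(Real.log m + 2 * ℓ + 7)) = (m : ℝ)⁻¹ * δ ^ 2 * Real.exp (-7) := by
      have e : -(Real.log m + 2 * ℓ + 7) = -Real.log m + (-ℓ + -ℓ) + -7 := by ring
      have e2 : Real.exp (-ℓ) = δ := by
        rw [Real.exp_neg, hℓ, Real.exp_log (by positivity)]
        simp
      rw [e, Real.exp_add, Real.exp_add, Real.exp_add, e2, Real.exp_neg (Real.log m),
        Real.exp_log (by positivity)]
      ring
    have h4 : Real.exp (-7 : ℝ) ≤ 1 / 100 := by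
      have e : Real.exp (-7 : ℝ) = (Real.exp 1 ^ 7)⁻¹ := by
        rw [← Real.exp_nat_mul, ← Real.exp_neg]; norm_num
      rw [e, inv_le_comm₀ (by positivity) (by norm_num)]
      calc (1 / 100 : ℝ)⁻¹ ≤ 2 ^ 7 := by norm_num
        _ ≤ _ := by
          gcongr
          linarith [Real.exp_one_gt_d9]
    calc 10 * B * m * Real.exp (-((ε / 16) ^ 2 * w / 8))
        ≤ 10 * (5 * (1 / δ)) * m * ((m : ℝ)⁻¹ * δ ^ 2 * (1 / 100)) := by
          refine mul_le_mul (by gcongr) (h2.trans (h3.le.trans ?_)) (Real.exp_pos _).le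
            (by positivity)
          gcongr
      _ = δ / 2 := by
          field_simp
          norm_num

theorem abs_tiltedValue_sub_le (hn : 0 < n) {γ : ℝ} (hγ0 : γ ≠ 0) (hγ : |γ| ≤ 1)
    {ρ P : Fin n → Matrix (Fin d) (Fin d) ℂ} (hρ : ∀ i, IsDensity (ρ i))
    (hP : ∀ i, IsStarProjection (P i)) :
    |tiltedValue γ ρ P - (∑ i, siteProb (ρ i) (P i)) / n| ≤ |γ| / 4 :=
  abs_tilted_mean_sub_le hn hγ0 hγ (fun i => siteProb_nonneg (hρ i) (hP i))
    fun i => siteProb_le_one (hρ i) (hP i)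

end Main

/-! ### The trivial range `ε > 1/2` -/

section Coarse

variable {n d : ℕ}

theorem log_mean_exp_mem {n : ℕ} (hn : 0 < n) {l u : ℝ} {x : Fin n → ℝ} (h0 : ∀ i, l ≤ x i)
    (h1 : ∀ i, x i ≤ u) :
    l ≤ Real.log (1 / (n : ℝ) * ∑ i, Real.exp (x i)) ∧
      Real.log (1 / (n : ℝ) * ∑ i, Real.exp (x i)) ≤ u := by
  have hn' : (0 : ℝ) < n := by exact_mod_cast hn
  have a0 : (n : ℝ) * Real.exp l ≤ ∑ i, Real.exp (x i) := by
    calc (n : ℝ) * Real.exp l = ∑ _i : Fin n, Real.exp l := by simp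
      _ ≤ _ := Finset.sum_le_sum fun i _ => Real.exp_le_exp.mpr (h0 i)
  have a1 : ∑ i, Real.exp (x i) ≤ n * Real.exp u := by
    calc ∑ i, Real.exp (x i) ≤ ∑ _i : Fin n, Real.exp u :=
          Finset.sum_le_sum fun i _ => Real.exp_le_exp.mpr (h1 i)
      _ = _ := by simp
  have b0 : Real.exp l ≤ 1 / (n : ℝ) * ∑ i, Real.exp (x i) := by
    rw [one_div, ← div_eq_inv_mul, le_div_iff₀ hn', mul_comm]
    exact a0
  have b1 : 1 / (n : ℝ) * ∑ i, Real.exp (x i) ≤ Real.exp u := by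
    rw [one_div, ← div_eq_inv_mul, div_le_iff₀ hn', mul_comm (Real.exp u)]
    exact a1
  have hpos := (Real.exp_pos l).trans_le b0
  exact ⟨(Real.le_log_iff_exp_le hpos).mpr b0, (Real.log_le_iff_le_exp hpos).mpr b1⟩

theorem tiltedValue_mem_Icc (hn : 0 < n) {γ : ℝ} (hγ0 : γ ≠ 0)
    {ρ P : Fin n → Matrix (Fin d) (Fin d) ℂ} (hρ : ∀ i, IsDensity (ρ i))
    (hP : ∀ i, IsStarProjection (P i)) : tiltedValue γ ρ P ∈ Set.Icc (0 : ℝ) 1 := by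
  have h0 : ∀ i, 0 ≤ ((ρ i * P i).trace).re := fun i => siteProb_nonneg (hρ i) (hP i)
  have h1 : ∀ i, ((ρ i * P i).trace).re ≤ 1 := fun i => siteProb_le_one (hρ i) (hP i)
  rw [tiltedValue, one_div_mul_eq_div]
  rcases lt_or_gt_of_ne hγ0 with h | h
  · obtain ⟨l, u⟩ := log_mean_exp_mem hn (l := γ) (u := 0)
      (x := fun i => γ * ((ρ i * P i).trace).re) (fun i => by nlinarith [h0 i, h1 i])
      (fun i => mul_nonpos_of_nonpos_of_nonneg h.le (h0 i))
    exact ⟨div_nonneg_of_nonpos u h.le, (div_le_one_of_neg h).mpr l⟩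
  · obtain ⟨l, u⟩ := log_mean_exp_mem hn (l := 0) (u := γ)
      (x := fun i => γ * ((ρ i * P i).trace).re) (fun i => mul_nonneg h.le (h0 i))
      (fun i => by nlinarith [h0 i, h1 i])
    exact ⟨div_nonneg l h.le, (div_le_one h).mpr u⟩

/-- For `ε > 1/2` the output `1/2` is accurate without any measurement. -/
theorem prob_output_half {m : ℕ} (hm : 0 < m) {ε : ℝ} (hε : 1 / 2 < ε) {μ : Fin m → ℝ}
    (hμ : ∀ c, μ c ∈ Set.Icc (0 : ℝ) 1)
    (σ : Matrix (Fin n → Fin d) (Fin n → Fin d) ℂ) :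
    (Algorithm.output ((⟨0, hm⟩ : Fin m), (1 / 2 : ℝ))).prob
      {o | ε ≤ |o.2 - ⨆ c, μ c| ∨ ε ≤ |o.2 - μ o.1|} σ = 0 := by
  have hne : Nonempty (Fin m) := ⟨⟨0, hm⟩⟩
  have habs : ∀ x ∈ Set.Icc (0 : ℝ) 1, |1 / 2 - x| < ε := fun x hx =>
    abs_lt.mpr ⟨by linarith [hx.2], by linarith [hx.1]⟩
  have hsup : (⨆ c, μ c) ∈ Set.Icc (0 : ℝ) 1 :=
    ⟨(hμ ⟨0, hm⟩).1.trans (le_ciSup (Set.finite_range μ).bddAbove _), ciSup_le fun c => (hμ c).2⟩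
  rw [Algorithm.prob, Set.indicator_of_notMem]
  rintro (h | h)
  · exact absurd h (not_le.mpr (habs _ hsup))
  · exact absurd h (not_le.mpr (habs _ (hμ _)))

theorem sampleSize_pos {C : ℝ} (hC : 0 < C) {m : ℕ} (hm : 1 ≤ m) {ε δ : ℝ} (γ : ℝ) (hε : 0 < ε)
    (hε1 : ε < 1) (hδ : 0 < δ) (hδ1 : δ < 1) : 0 < sampleSize C m ε δ γ := by
  have h1 : 0 < Real.log (1 / δ) := Real.log_pos ((one_lt_div hδ).mpr hδ1)
  have h2 : 0 < Real.log (1 / ε) := Real.log_pos ((one_lt_div hε).mpr hε1)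
  have h3 : 0 ≤ Real.log m := Real.log_nonneg (by exact_mod_cast hm)
  have h4 : 0 < (Real.log m + C) ^ 2 := by positivity
  exact mul_pos (by positivity) (lt_max_of_lt_right h4)

end Coarse

end QTERM

theorem theorem2 :
    ∃ A C : ℝ, 0 < A ∧ 0 < C ∧
      ∀ (d m n : ℕ) (ε δ γ : ℝ), 1 ≤ m → 0 < ε → ε < 1 → 0 < δ → δ ≤ 1 / 2 →
        0 < |γ| → |γ| < ε →
        A * QTERM.sampleSize C m ε δ γ ≤ (n : ℝ) →
        ∀ P : Fin m → Fin n → Matrix (Fin d) (Fin d) ℂ, (∀ c i, IsStarProjection (P c i)) →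
          ∃ alg : QTERM.Algorithm (Fin n → Fin d) (Fin m × ℝ),
            ∀ ρ : Fin n → Matrix (Fin d) (Fin d) ℂ, (∀ i, QTERM.IsDensity (ρ i)) →
              alg.prob
                {o : Fin m × ℝ |
                  ε ≤ |o.2 - ⨆ c : Fin m, QTERM.tiltedValue γ ρ (P c)| ∨
                  ε ≤ |o.2 - QTERM.tiltedValue γ ρ (P o.1)|}
                (QTERM.productState ρ) ≤ δ := by
  refine ⟨1000000, 3, by norm_num, by norm_num, ?_⟩
  intro d m n ε δ γ hm hε hε1 hδ hδ1 hγ hγε hN P hP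
  have hγ0 : γ ≠ 0 := abs_pos.mp hγ
  -- As `ε → 1` the factor `log² (1/ε)` tends to 0 and the sample size guarantees no large blocks.
  -- For `ε > 1/2` the constant answer `1/2` suffices, since tilted values lie in `[0, 1]` when `n >
  -- 0`.
  rcases le_or_gt ε (1 / 2) with h | h
  · obtain ⟨B, hn, hB, hbig, hB1, hB2⟩ :=
      QTERM.blocks_large_of_sampleSize hm hε h hδ hδ1 hγ hN
    obtain ⟨alg, halg⟩ := QTERM.exists_algorithm_of_blocks hn hB hm hε hε1.le rfl hbig hB1 hB2 hP
    refine ⟨alg, fun ρ hρ => halg ρ hρ (fun c => QTERM.tiltedValue γ ρ (P c)) fun c => ?_⟩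
    exact (QTERM.abs_tiltedValue_sub_le hn hγ0 (by linarith) hρ (hP c)).trans (by linarith)
  · have hn : 0 < n := by
      have h1 := QTERM.sampleSize_pos (C := 3) (by norm_num) hm γ hε hε1 hδ
        (by linarith : δ < 1)
      have : (0 : ℝ) < n := lt_of_lt_of_le (by positivity) hN
      exact_mod_cast this
    exact ⟨_, fun ρ hρ => (QTERM.prob_output_half hm h
      (fun c => QTERM.tiltedValue_mem_Icc hn hγ0 hρ (hP c)) _).trans_le hδ.le⟩
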